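/- All functions are real valued and defined on $\mathbb{R}$. Let $X$ be one of the following locally convex Hausdorff spaces. - $C^m(\mathbb{R})$, $m\in\{0,1,2,\dots\}\cup\{\infty\}$, with the topology of uniform convergence on compact sets of all derivatives of order $\le m$. - $\mathcal{O}^m(\mathbb{R})$, $m\in\{0,1,2,\dots\}$, the locally convex inductive limit over $n\in\mathbb{N}$ of the Banach spaces $\mathcal{O}^m_n(\mathbb{R})=\{f\in C^m(\mathbb{R}) : |f|_{m,n}:=\sup_{x\in\mathbb{R}}\max_{0\le i\le m}(1+x^2)^{-n}|f^{(i)}(x)|<\infty\}$. - $\mathcal{O}_M(\mathbb{R})=\bigcap_{m}\mathcal{O}^m(\mathbb{R})$, with the projective limit topology of the spaces $\mathcal{O}^m(\mathbb{R})$. - $\mathcal{A}(\mathbb{R})$, the space of real analytic functions on $\mathbb{R}$, with its usual topology, i.e. the locally convex inductive limit, over all open neighbourhoods $U$ of $\mathbb{R}$ in $\mathbb{C}$, of the spaces of holomorphic functions on $U$ that are real valued on $\mathbb{R}$, each with the topology of uniform convergence on compact subsets of $U$. Let $\varphi$ be a polynomial with real coefficients, and let $\varphi_n$ be its $n$-th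 iterate under composition. Then $C_\varphi\colon f\mapsto f\circ\varphi$ is a well-defined continuous linear operator $X\to X$, and the following are equivalent: 1. $C_\varphi$ is mean ergodic on $X$, i.e. there is a continuous linear operator $P$ on $X$ such that $\frac1n\sum_{k=1}^n C_\varphi^k f\to Pf$ in $X$ for every $f\in X$; 2. $C_\varphi$ is power bounded on $X$, i.e. $\{C_\varphi^n : n\in\mathbb{N}\}$ is equicontinuous; 3. $\varphi(x)=ax+b$ with $a,b\in\mathbb{R}$ and either $|a|<1$, or $a=-1$, or $a=1$ and $b=0$. If $\varphi(x)=ax+b$ with $|a|<1$, then moreover the sequence of iterates $\{C_{\varphi_n}\}_{n}$ converges in the strong operator topology, i.e. there is a continuous linear operator $Q$ on $X$ such that $f\circ\varphi_n\to Qf$ in $X$ for every $f\in X$. -/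

import Mathlib

open Filter Topology Set
open scoped ContDiff

/-! ### Locally convex spaces of functions on the real line -/

/-- A locally convex Hausdorff space of functions `ℝ → ℝ`: a linear space of functions with a
locally convex Hausdorff vector space topology of its own (in general not the topology of
pointwise convergence). -/
structure FunctionSpace where
  toSubmodule : Submodule ℝ (ℝ → ℝ)
  top : TopologicalSpace toSubmodule
  isTopologicalAddGroup : @IsTopologicalAddGroup toSubmodule top _
  continuousSMul : @ContinuousSMul ℝ toSubmodule _ _ top
  locallyConvexSpace : @LocallyConvexSpace ℝ toSubmodule _ _ _ _ top
  t2Space : @T2Space toSubmodule top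

namespace FunctionSpace

/-- The elements of a function space. This is a separate type, so that it carries the topology
`X.top` and not the topology induced by the product topology of `ℝ → ℝ`. -/
def Elem (X : FunctionSpace) : Type := X.toSubmodule

instance (X : FunctionSpace) : AddCommGroup X.Elem :=
  inferInstanceAs (AddCommGroup X.toSubmodule)

instance (X : FunctionSpace) : Module ℝ X.Elem :=
  inferInstanceAs (Module ℝ X.toSubmodule)

instance (X : FunctionSpace) : TopologicalSpace X.Elem := X.top

instance (X : FunctionSpace) : IsTopologicalAddGroup X.Elem := X.isTopologicalAddGroup

instance (X : FunctionSpace) : ContinuousSMul ℝ X.Elem := X.continuousSMul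

instance (X : FunctionSpace) : LocallyConvexSpace ℝ X.Elem := X.locallyConvexSpace

instance (X : FunctionSpace) : T2Space X.Elem := X.t2Space

/-- A function that belongs to `X`, as an element of `X`. -/
def Elem.mk {X : FunctionSpace} (f : ℝ → ℝ) (hf : f ∈ X.toSubmodule) : X.Elem := ⟨f, hf⟩

/-- The function `ℝ → ℝ` that an element of `X` is. -/
def Elem.toFun {X : FunctionSpace} (f : X.Elem) : ℝ → ℝ := f.1

theorem Elem.toFun_mem {X : FunctionSpace} (f : X.Elem) : f.toFun ∈ X.toSubmodule := f.2

/-- `φ` is a symbol for `X`: the space `X` is stable under `f ↦ f ∘ φ`, and this map is continuous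
on `X`. -/
structure IsSymbol (X : FunctionSpace) (φ : ℝ → ℝ) : Prop where
  comp_mem : ∀ f ∈ X.toSubmodule, f ∘ φ ∈ X.toSubmodule
  continuous_comp : Continuous fun f : X.Elem => Elem.mk (f.toFun ∘ φ) (comp_mem f.toFun f.toFun_mem)

/-- The composition operator `C_φ : X → X`, `f ↦ f ∘ φ`, of a symbol `φ` for `X`. -/
def compositionOperator {X : FunctionSpace} {φ : ℝ → ℝ} (h : X.IsSymbol φ) :
    X.Elem →L[ℝ] X.Elem where
  toFun f := Elem.mk (f.toFun ∘ φ) (h.comp_mem f.toFun f.toFun_mem)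
  map_add' _ _ := rfl
  map_smul' _ _ := rfl
  cont := h.continuous_comp

/-- The iterates of a symbol are symbols. -/
theorem IsSymbol.iterate {X : FunctionSpace} {φ : ℝ → ℝ} (h : X.IsSymbol φ) (n : ℕ) :
    X.IsSymbol φ^[n] := by
  induction n with
  | zero => exact ⟨fun f hf => hf, continuous_id⟩
  | succ n ih =>
    exact ⟨fun f hf => h.comp_mem _ (ih.comp_mem f hf), h.continuous_comp.comp ih.continuous_comp⟩

end FunctionSpace

/-! ### Operators on topological vector spaces -/

section Operators

variable {E : Type*} [AddCommGroup E] [Module ℝ E] [TopologicalSpace E] [IsTopologicalAddGroup E]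
  [ContinuousSMul ℝ E]

/-- `T` is power bounded: its powers form an equicontinuous family, with respect to the canonical
uniform structure of the topological vector space. -/
def IsPowerBounded (T : E →L[ℝ] E) : Prop :=
  letI : UniformSpace E := IsTopologicalAddGroup.rightUniformSpace E
  Equicontinuous fun (n : ℕ) (x : E) => (T ^ n) x

/-- The sequence `S` of operators converges in the strong operator topology to some continuous
linear operator. -/
def ConvergesStrongly (S : ℕ → E →L[ℝ] E) : Prop :=
  ∃ P : E →Lₚₜ[ℝ] E,
    Tendsto (fun n => ContinuousLinearMap.toPointwiseConvergenceCLM ℝ (RingHom.id ℝ) E E (S n))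
      atTop (𝓝 P)

/-- The Cesàro mean `(T + T² + ⋯ + Tⁿ) / n`, for `n ≥ 1`. -/
noncomputable def cesaroMean (T : E →L[ℝ] E) (n : ℕ) : E →L[ℝ] E :=
  (n : ℝ)⁻¹ • ∑ k ∈ Finset.Icc 1 n, T ^ k

/-- `T` is mean ergodic: its Cesàro means converge in the strong operator topology. -/
def IsMeanErgodic (T : E →L[ℝ] E) : Prop :=
  ConvergesStrongly (cesaroMean T)

end Operators

/-! ### Locally convex inductive limits -/

section Inductive

variable {E : Type*} [AddCommGroup E] [Module ℝ E]

/-- The locally convex inductive topology on `E`: the finest locally convex vector space topology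
for which all the maps `j i : F i → E` are continuous. (In the order on topologies used here, finer
topologies are smaller, so `sInf` is the topology generated by all the topologies listed.) -/
@[reducible]
def inductiveTopology {ι : Type*} {F : ι → Type*} [∀ i, TopologicalSpace (F i)]
    (j : ∀ i, F i → E) : TopologicalSpace E :=
  sInf {t : TopologicalSpace E | (∀ i, @Continuous _ _ _ t (j i)) ∧ @IsTopologicalAddGroup E t _ ∧
    @ContinuousSMul ℝ E _ _ t ∧ @LocallyConvexSpace ℝ E _ _ _ _ t}

theorem inductiveTopology_isTopologicalAddGroup {ι : Type*} {F : ι → Type*}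
    [∀ i, TopologicalSpace (F i)] (j : ∀ i, F i → E) :
    @IsTopologicalAddGroup E (inductiveTopology j) _ :=
  topologicalAddGroup_sInf fun _ h => h.2.1

theorem inductiveTopology_continuousSMul {ι : Type*} {F : ι → Type*}
    [∀ i, TopologicalSpace (F i)] (j : ∀ i, F i → E) :
    @ContinuousSMul ℝ E _ _ (inductiveTopology j) :=
  continuousSMul_sInf fun _ h => h.2.2.1

theorem inductiveTopology_locallyConvexSpace {ι : Type*} {F : ι → Type*}
    [∀ i, TopologicalSpace (F i)] (j : ∀ i, F i → E) :
    @LocallyConvexSpace ℝ E _ _ _ _ (inductiveTopology j) :=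
  .sInf fun _ h => h.2.2.2

theorem inductiveTopology_continuous {ι : Type*} {F : ι → Type*} [∀ i, TopologicalSpace (F i)]
    (j : ∀ i, F i → E) (i : ι) : @Continuous _ _ _ (inductiveTopology j) (j i) :=
  continuous_sInf_rng.2 fun _ h => h.1 i

/-- An inductive topology on a space of functions is finer than pointwise convergence, provided
that the topologies of the steps are. -/
theorem inductiveTopology_le_pointwise {S : Submodule ℝ (ℝ → ℝ)} {ι : Type*} {F : ι → Type*}
    [∀ i, TopologicalSpace (F i)] (j : ∀ i, F i → S)
    (h : ∀ i x, Continuous fun f => (j i f : ℝ → ℝ) x) :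
    inductiveTopology j ≤ instTopologicalSpaceSubtype :=
  sInf_le ⟨fun i => Continuous.subtype_mk (continuous_pi (h i)) fun f => (j i f).2,
    inferInstance, inferInstance, inferInstance⟩

/-- A topology on a space of functions that is finer than pointwise convergence is Hausdorff. -/
theorem t2Space_of_le_pointwise {S : Submodule ℝ (ℝ → ℝ)} {t : TopologicalSpace S}
    (h : t ≤ instTopologicalSpaceSubtype) : @T2Space S t :=
  t2Space_antitone h inferInstance

end Inductive

/-! ### The spaces `C^m(ℝ)`, for `m` a natural number or `∞` -/

/-- The functions of class `C^m`. -/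
def smoothSubmodule (m : ℕ∞) : Submodule ℝ (ℝ → ℝ) where
  carrier := {f | ContDiff ℝ m f}
  add_mem' := by
    intro f g (hf : ContDiff ℝ m f) (hg : ContDiff ℝ m g)
    exact hf.add hg
  zero_mem' := by
    change ContDiff ℝ m fun _ : ℝ => (0 : ℝ)
    exact contDiff_const
  smul_mem' := by
    intro c f (hf : ContDiff ℝ m f)
    exact hf.const_smul c

theorem contDiff_of_mem_smooth {m : ℕ∞} (f : smoothSubmodule m) : ContDiff ℝ m f.1 := f.2

/-- The `i`-th derivative as a linear map from `C^m(ℝ)` to `C(ℝ)`, for `i ≤ m`. -/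
noncomputable def smoothDeriv (m : ℕ∞) (i : ℕ) (hi : (i : ℕ∞) ≤ m) :
    smoothSubmodule m →ₗ[ℝ] C(ℝ, ℝ) where
  toFun f := ⟨iteratedDeriv i f.1, (contDiff_of_mem_smooth f).continuous_iteratedDeriv i (by exact_mod_cast hi)⟩
  map_add' f g := by
    ext x
    exact iteratedDeriv_add
      ((contDiff_of_mem_smooth f).of_le (by exact_mod_cast hi)).contDiffAt
      ((contDiff_of_mem_smooth g).of_le (by exact_mod_cast hi)).contDiffAt
  map_smul' c f := by
    ext x
    exact iteratedDeriv_const_smul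
      ((contDiff_of_mem_smooth f).of_le (by exact_mod_cast hi)).contDiffAt c

/-- The topology of `C^m(ℝ)`: uniform convergence on compact sets of all the derivatives of
order `≤ m`. (The space `C(ℝ, ℝ)` carries the compact-open topology.) -/
@[reducible]
noncomputable def smoothTopology (m : ℕ∞) : TopologicalSpace (smoothSubmodule m) :=
  ⨅ i : {i : ℕ // (i : ℕ∞) ≤ m}, .induced (smoothDeriv m i.1 i.2) inferInstance

/-- The space `C^m(ℝ)`. -/
noncomputable def smoothSpace (m : ℕ∞) : FunctionSpace where
  toSubmodule := smoothSubmodule m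
  top := smoothTopology m
  isTopologicalAddGroup := topologicalAddGroup_iInf fun i => topologicalAddGroup_induced _
  continuousSMul := continuousSMul_iInf fun i => continuousSMul_induced _
  locallyConvexSpace := .iInf fun i => .induced _
  t2Space := by
    apply t2Space_of_le_pointwise
    have h0 : ((0 : ℕ) : ℕ∞) ≤ m := by simp
    refine (iInf_le _ ⟨0, h0⟩).trans (continuous_iff_le_induced.1 ?_)
    let : TopologicalSpace (smoothSubmodule m) :=
      .induced (smoothDeriv m 0 h0) inferInstance
    have h : Continuous (smoothDeriv m 0 h0) := continuous_induced_dom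
    refine continuous_pi fun x => ?_
    have := (ContinuousEvalConst.continuous_eval_const (F := C(ℝ, ℝ)) x).comp h
    simpa [Function.comp_def, smoothDeriv] using this

/-! ### The spaces `𝒪^m(ℝ)` and `𝒪_M(ℝ)` -/

/-- The space `𝒪^m_n(ℝ)` of the `C^m` functions `f` such that the quantities
`|f^(i)(x)| / (1 + x²)^n`, for `i ≤ m` and `x ∈ ℝ`, are bounded. -/
def growthSubmodule (m n : ℕ) : Submodule ℝ (ℝ → ℝ) where
  carrier := {f | ContDiff ℝ m f ∧
    ∃ C : ℝ, ∀ i ≤ m, ∀ x : ℝ, |iteratedDeriv i f x| / (1 + x ^ 2) ^ n ≤ C}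
  add_mem' := by
    rintro f g ⟨hf, C, hC⟩ ⟨hg, D, hD⟩
    refine ⟨hf.add hg, C + D, fun i hi x => ?_⟩
    rw [iteratedDeriv_add (hf.of_le (by exact_mod_cast hi)).contDiffAt
      (hg.of_le (by exact_mod_cast hi)).contDiffAt]
    refine le_trans ?_ (add_le_add (hC i hi x) (hD i hi x))
    rw [← add_div]
    gcongr
    exact abs_add_le _ _
  zero_mem' := by
    refine ⟨contDiff_const, 0, fun i hi x => ?_⟩
    have h : iteratedDeriv i (0 : ℝ → ℝ) x = 0 := by
      have := iteratedDeriv_fun_const_zero (𝕜 := ℝ) (F := ℝ) (n := i) (x := x)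
      exact this
    simp [h]
  smul_mem' := by
    rintro c f ⟨hf, C, hC⟩
    refine ⟨contDiff_const.smul hf, |c| * C, fun i hi x => ?_⟩
    rw [iteratedDeriv_const_smul (hf.of_le (by exact_mod_cast hi)).contDiffAt c, smul_eq_mul,
      abs_mul, mul_div_assoc]
    exact mul_le_mul_of_nonneg_left (hC i hi x) (abs_nonneg c)

/-- `𝒪^m_n(ℝ)` as a type, which carries its own norm. -/
def GrowthStep (m n : ℕ) : Type := growthSubmodule m n

namespace GrowthStep

variable {m n : ℕ}

instance : AddCommGroup (GrowthStep m n) := inferInstanceAs (AddCommGroup (growthSubmodule m n))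

instance : Module ℝ (GrowthStep m n) := inferInstanceAs (Module ℝ (growthSubmodule m n))

theorem bddAbove (f : GrowthStep m n) : BddAbove (range fun q : Fin (m + 1) × ℝ =>
    |iteratedDeriv q.1 f.1 q.2| / (1 + q.2 ^ 2) ^ n) := by
  obtain ⟨C, hC⟩ := f.2.2
  refine ⟨C, ?_⟩
  rintro _ ⟨q, rfl⟩
  exact hC q.1 (Nat.lt_succ_iff.1 q.1.2) q.2

/-- The norm `sup { |f^(i)(x)| / (1 + x²)^n : i ≤ m, x ∈ ℝ }` on `𝒪^m_n(ℝ)`. -/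
noncomputable def norm (m n : ℕ) : AddGroupNorm (GrowthStep m n) where
  toFun f := ⨆ q : Fin (m + 1) × ℝ, |iteratedDeriv q.1 f.1 q.2| / (1 + q.2 ^ 2) ^ n
  map_zero' := by
    have h (i : ℕ) (x : ℝ) : iteratedDeriv i (0 : GrowthStep m n).1 x = 0 := by
      have := iteratedDeriv_fun_const_zero (𝕜 := ℝ) (F := ℝ) (n := i) (x := x)
      exact this
    simp [h]
  add_le' f g := by
    refine ciSup_le fun q => ?_
    have hq : (q.1 : ℕ) ≤ m := Nat.lt_succ_iff.1 q.1.2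
    have h : iteratedDeriv q.1 (f + g).1 q.2
        = iteratedDeriv q.1 f.1 q.2 + iteratedDeriv q.1 g.1 q.2 :=
      iteratedDeriv_add (f.2.1.of_le (by exact_mod_cast hq)).contDiffAt
        (g.2.1.of_le (by exact_mod_cast hq)).contDiffAt
    rw [h]
    refine le_trans ?_ (add_le_add (le_ciSup f.bddAbove q) (le_ciSup g.bddAbove q))
    rw [← add_div]
    gcongr
    exact abs_add_le _ _
  neg' f := by
    have h (i : ℕ) (x : ℝ) : iteratedDeriv i (-f).1 x = -iteratedDeriv i f.1 x :=
      iteratedDeriv_neg i f.1 x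
    simp [h]
  eq_zero_of_map_eq_zero' f hf := by
    refine Subtype.ext (funext fun x => ?_)
    have h := le_ciSup f.bddAbove (0, x)
    rw [hf] at h
    have h1 : (0 : ℝ) < (1 + x ^ 2) ^ n := by positivity
    rw [div_le_iff₀ h1, zero_mul] at h
    have h2 : |f.1 x| ≤ 0 := by simpa using h
    exact abs_nonpos_iff.1 h2

noncomputable instance : NormedAddCommGroup (GrowthStep m n) :=
  (norm m n).toNormedAddCommGroup

theorem norm_def (f : GrowthStep m n) :
    ‖f‖ = ⨆ q : Fin (m + 1) × ℝ, |iteratedDeriv q.1 f.1 q.2| / (1 + q.2 ^ 2) ^ n :=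
  rfl

theorem continuous_eval (x : ℝ) : Continuous fun f : GrowthStep m n => f.1 x := by
  refine (LipschitzWith.of_dist_le_mul (K := Real.toNNReal ((1 + x ^ 2) ^ n))
    fun f g => ?_).continuous
  have h := le_ciSup (f - g).bddAbove (0, x)
  rw [← norm_def, div_le_iff₀ (by positivity)] at h
  rw [dist_eq_norm f g, Real.dist_eq, Real.coe_toNNReal _ (by positivity), mul_comm]
  exact h

end GrowthStep

theorem growthSubmodule_mono (m : ℕ) : Monotone (growthSubmodule m) := by
  rintro n n' hn f ⟨hf, C, hC⟩
  refine ⟨hf, C, fun i hi x => le_trans ?_ (hC i hi x)⟩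
  gcongr
  nlinarith [sq_nonneg x]

/-- The functions in `𝒪^m(ℝ)`, the union of the increasing sequence of the spaces `𝒪^m_n(ℝ)`. -/
def slowSubmodule (m : ℕ) : Submodule ℝ (ℝ → ℝ) where
  carrier := ⋃ n : ℕ, (growthSubmodule m n : Set (ℝ → ℝ))
  add_mem' := by
    intro f g hf hg
    obtain ⟨n, hf⟩ := mem_iUnion.1 hf
    obtain ⟨n', hg⟩ := mem_iUnion.1 hg
    exact mem_iUnion.2 ⟨max n n', add_mem (growthSubmodule_mono m (le_max_left n n') hf)
      (growthSubmodule_mono m (le_max_right n n') hg)⟩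
  zero_mem' := mem_iUnion.2 ⟨0, zero_mem _⟩
  smul_mem' := by
    intro c f hf
    obtain ⟨n, hf⟩ := mem_iUnion.1 hf
    exact mem_iUnion.2 ⟨n, Submodule.smul_mem _ c hf⟩

/-- The inclusion of `𝒪^m_n(ℝ)` into `𝒪^m(ℝ)`. -/
def GrowthStep.incl (m n : ℕ) (f : GrowthStep m n) : slowSubmodule m :=
  ⟨f.1, mem_iUnion.2 ⟨n, f.2⟩⟩

/-- The space `𝒪^m(ℝ)`, the locally convex inductive limit over `n` of the normed spaces
`𝒪^m_n(ℝ)`. (The step `n = 0`, which is contained in the step `n = 1`, changes nothing.) -/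
noncomputable def slowSpace (m : ℕ) : FunctionSpace where
  toSubmodule := slowSubmodule m
  top := inductiveTopology (GrowthStep.incl m)
  isTopologicalAddGroup := inductiveTopology_isTopologicalAddGroup _
  continuousSMul := inductiveTopology_continuousSMul (GrowthStep.incl m)
  locallyConvexSpace := inductiveTopology_locallyConvexSpace (GrowthStep.incl m)
  t2Space := t2Space_of_le_pointwise
    (inductiveTopology_le_pointwise _ fun _ x => GrowthStep.continuous_eval x)

/-- The functions in `𝒪_M(ℝ)`, the intersection of the spaces `𝒪^m(ℝ)`. -/
def multiplierSubmodule : Submodule ℝ (ℝ → ℝ) := ⨅ m : ℕ, slowSubmodule m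

/-- The inclusion of `𝒪_M(ℝ)` into `𝒪^m(ℝ)`. -/
noncomputable def multiplierIncl (m : ℕ) : multiplierSubmodule →ₗ[ℝ] (slowSpace m).Elem where
  toFun f := FunctionSpace.Elem.mk f.1 (iInf_le slowSubmodule m f.2)
  map_add' _ _ := rfl
  map_smul' _ _ := rfl

/-- The space `𝒪_M(ℝ)` of slowly increasing smooth functions, the projective limit over `m` of the
spaces `𝒪^m(ℝ)`. -/
noncomputable def multiplierSpace : FunctionSpace where
  toSubmodule := multiplierSubmodule
  top := ⨅ m : ℕ, .induced (multiplierIncl m) inferInstance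
  isTopologicalAddGroup := topologicalAddGroup_iInf fun m => topologicalAddGroup_induced _
  continuousSMul := continuousSMul_iInf fun m => continuousSMul_induced _
  locallyConvexSpace := .iInf fun m => .induced _
  t2Space := by
    apply t2Space_of_le_pointwise
    refine (iInf_le _ 0).trans (continuous_iff_le_induced.1 ?_)
    have h1 : (slowSpace 0).top ≤ instTopologicalSpaceSubtype :=
      inductiveTopology_le_pointwise _ fun _ x => GrowthStep.continuous_eval x
    have h2 : Continuous fun f : (slowSpace 0).Elem => f.toFun :=
      continuous_iff_le_induced.2 (h1.trans (le_refl _))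
    let : TopologicalSpace multiplierSubmodule := .induced (multiplierIncl 0) inferInstance
    have h3 : Continuous (multiplierIncl 0) := continuous_induced_dom
    exact h2.comp h3

/-! ### The space `𝒜(ℝ)` of real analytic functions -/

/-- The real analytic functions on `ℝ`. -/
def analyticSubmodule : Submodule ℝ (ℝ → ℝ) where
  carrier := {f | AnalyticOnNhd ℝ f univ}
  add_mem' := by
    intro f g (hf : AnalyticOnNhd ℝ f univ) (hg : AnalyticOnNhd ℝ g univ)
    exact hf.add hg
  zero_mem' := by
    change AnalyticOnNhd ℝ (fun _ : ℝ => (0 : ℝ)) univ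
    exact analyticOnNhd_const
  smul_mem' := by
    intro c f (hf : AnalyticOnNhd ℝ f univ)
    exact (analyticOnNhd_const (v := c)).smul hf

/-- The open neighbourhoods of `ℝ` in `ℂ`. -/
def ComplexNhd : Type := {U : Set ℂ // IsOpen U ∧ ∀ x : ℝ, (x : ℂ) ∈ U}

/-- The functions holomorphic on `U` and real valued on `ℝ`. (The values off `U` play no role.) -/
def HolomorphicOn (U : ComplexNhd) : Type :=
  {F : ℂ → ℂ // DifferentiableOn ℂ F U.1 ∧ ∀ x : ℝ, (F x).im = 0}

namespace HolomorphicOn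

variable {U : ComplexNhd}

/-- The restriction to `U`, as a continuous function on `U`. -/
def restrict (F : HolomorphicOn U) : C(U.1, ℂ) :=
  ⟨U.1.domRestrict F.1, F.2.1.continuousOn.domRestrict⟩

/-- The topology of uniform convergence on the compact subsets of `U`. -/
noncomputable instance : TopologicalSpace (HolomorphicOn U) := .induced restrict inferInstance

/-- The restriction to `ℝ`, which is a real analytic function. -/
def toReal (U : ComplexNhd) (F : HolomorphicOn U) : analyticSubmodule :=
  ⟨fun x => (F.1 x).re, fun x _ =>
    (F.2.1.analyticAt (U.2.1.mem_nhds (U.2.2 x))).re_ofReal⟩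

theorem continuous_toReal_apply (x : ℝ) :
    Continuous fun F : HolomorphicOn U => (toReal U F : ℝ → ℝ) x := by
  have h : Continuous (restrict (U := U)) := continuous_induced_dom
  exact Complex.continuous_re.comp
    ((ContinuousEvalConst.continuous_eval_const (F := C(U.1, ℂ)) (⟨x, U.2.2 x⟩ : U.1)).comp h)

end HolomorphicOn

/-- The space `𝒜(ℝ)` of real analytic functions on `ℝ`, the locally convex inductive limit of the
spaces of holomorphic functions on the open neighbourhoods `U` of `ℝ` in `ℂ`, each with the
topology of uniform convergence on the compact subsets of `U`. (As the functions in `𝒜(ℝ)` are real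
valued here, so are on `ℝ` the holomorphic functions.) -/
noncomputable def analyticSpace : FunctionSpace where
  toSubmodule := analyticSubmodule
  top := inductiveTopology HolomorphicOn.toReal
  isTopologicalAddGroup := inductiveTopology_isTopologicalAddGroup _
  continuousSMul := inductiveTopology_continuousSMul HolomorphicOn.toReal
  locallyConvexSpace := inductiveTopology_locallyConvexSpace HolomorphicOn.toReal
  t2Space := t2Space_of_le_pointwise
    (inductiveTopology_le_pointwise _ fun _ x => HolomorphicOn.continuous_toReal_apply x)

/-! ### Locally convex spaces -/

section LocallyConvex

variable {E : Type*} [AddCommGroup E] [Module ℝ E] [TopologicalSpace E] [IsTopologicalAddGroup E]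

/-! Necessity needs one test function, `x ^ 2`, and continuity of the point evaluations. Convergent
Cesàro means force the square of the `n`-th iterate at `x` to be `o(n)`, and power boundedness even
makes it bounded. By `Polynomial.affine_of_tendsto_iterate` such slow growth at every `x` leaves
only the listed maps. In degree at least two, or for slope of modulus greater than one, some orbit
escapes exponentially; a nontrivial translation escapes linearly, and its square is not `o(n)`.

Sufficiency has two cases. The identity and the reflections are involutions, so there are at most
two distinct powers: Cesàro means converge and finitely many continuous operators are
equicontinuous. For `|a| < 1` there is a fixed point `p`, and the `n`-th iterate is the dilation
about `p` by `a ^ n`. What is needed is `FunctionSpace.IsContractive`: dilations with factors in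
`[-1, 1]` are equicontinuous, and converge to `f ↦ f p` when the factors tend to `0`. Convergence of
the powers then gives convergence of their Cesàro means by local convexity.

Contractivity is where the spaces differ. On `C^m` and on the steps of `𝒜(ℝ)`, dilation is jointly
continuous in the factor and the function, and the factors lie in a compact interval. On `𝒪^m_n` the
dilations are uniformly bounded, and they converge after adding one power of the weight. `𝒪_M`
inherits the property from all `𝒪^m`. For the inductive limits,
`equicontinuous_of_inductiveTopology` reduces equicontinuity to the steps. -/

theorem tendsto_seminorm_sub {α : Type*} {l : Filter α} {u : α → E} {y : E}
    (h : Tendsto u l (𝓝 y)) {q : Seminorm ℝ E} (hq : Continuous q) :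
    Tendsto (fun a => q (u a - y)) l (𝓝 0) := by
  have := (hq.tendsto (y - y)).comp (h.sub_const y)
  simpa [Function.comp_def] using this

/-- Power boundedness is uniform convergence to zero of the powers at zero. -/
theorem isPowerBounded_iff {T : E →L[ℝ] E} :
    IsPowerBounded T ↔ Tendsto (fun q : ℕ × E => (T ^ q.1) q.2) (⊤ ×ˢ 𝓝 0) (𝓝 0) := by
  let : UniformSpace E := IsTopologicalAddGroup.rightUniformSpace E
  have : IsUniformAddGroup E := isUniformAddGroup_of_addCommGroup
  have h1 : IsPowerBounded T ↔ EquicontinuousAt (fun (n : ℕ) (x : E) => (T ^ n) x) 0 :=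
    ⟨fun h => h 0, fun h => equicontinuous_of_equicontinuousAt_zero (fun n : ℕ => T ^ n) h⟩
  rw [h1, EquicontinuousAt]
  constructor
  · intro h V hV
    have hV' : {p : E × E | p.2 - p.1 ∈ V} ∈ uniformity E := by
      rw [uniformity_eq_comap_nhds_zero E]
      exact preimage_mem_comap hV
    rw [mem_map, mem_prod_iff]
    -- The only member of the filter `⊤` is `univ`, so a limit along `⊤ ×ˢ 𝓝 0` is a limit at zero
    -- uniform in `n`.
    refine ⟨univ, by simp, _, h _ hV', ?_⟩
    rintro ⟨n, x⟩ ⟨-, hx⟩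
    have := hx n
    simpa using this
  · intro h U hU
    rw [uniformity_eq_comap_nhds_zero E] at hU
    obtain ⟨V, hV, hVU⟩ := hU
    obtain ⟨A, hA, B, hB, hAB⟩ := mem_prod_iff.1 (h hV)
    filter_upwards [hB] with x hx n
    refine hVU ?_
    have := @hAB (n, x) ⟨by rw [mem_top.1 hA]; trivial, hx⟩
    simpa using this

variable [ContinuousSMul ℝ E]

/-- In a locally convex space, convergence is convergence for all continuous seminorms. -/
theorem tendsto_of_continuous_seminorm [LocallyConvexSpace ℝ E] {α : Type*} {l : Filter α}
    {u : α → E} {y : E}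
    (h : ∀ q : Seminorm ℝ E, Continuous q → Tendsto (fun a => q (u a - y)) l (𝓝 0)) :
    Tendsto u l (𝓝 y) := by
  have hE : WithSeminorms (gaugeSeminormFamily ℝ E) := with_gaugeSeminormFamily
  rw [hE.tendsto_nhds]
  intro i ε hε
  exact (h _ (hE.continuous_seminorm i)).eventually (gt_mem_nhds hε)

/-- The Cesàro means of a convergent sequence in a locally convex space converge. -/
theorem tendsto_cesaro_of_locallyConvex [LocallyConvexSpace ℝ E] {u : ℕ → E} {y : E}
    (h : Tendsto u atTop (𝓝 y)) :
    Tendsto (fun n : ℕ => (n : ℝ)⁻¹ • ∑ k ∈ Finset.Icc 1 n, u k) atTop (𝓝 y) := by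
  refine tendsto_of_continuous_seminorm fun q hq => ?_
  -- The shift by one is needed because `cesaro` averages from index `0`, the means here from `1`.
  have h1 := ((tendsto_seminorm_sub h hq).comp (tendsto_add_atTop_nat 1)).cesaro
  refine squeeze_zero' (.of_forall fun n => apply_nonneg q _) ?_ h1
  filter_upwards [eventually_gt_atTop 0] with n hn
  have hn' : (0 : ℝ) < n := by exact_mod_cast hn
  have h2 : ∑ k ∈ Finset.Icc 1 n, u k = ∑ i ∈ Finset.range n, u (i + 1) := by
    rw [Finset.range_eq_Ico, Finset.sum_Ico_add' u 0 n 1]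
    rfl
  have h3 : (n : ℝ)⁻¹ • ∑ k ∈ Finset.Icc 1 n, u k - y
      = (n : ℝ)⁻¹ • ∑ i ∈ Finset.range n, (u (i + 1) - y) := by
    rw [h2, Finset.sum_sub_distrib, Finset.sum_const, Finset.card_range, smul_sub,
      ← Nat.cast_smul_eq_nsmul ℝ, smul_smul, inv_mul_cancel₀ hn'.ne', one_smul]
  rw [h3, map_smul_eq_mul, Real.norm_of_nonneg (by positivity)]
  gcongr
  exact Finset.le_sum_of_subadditive q (map_zero q).le (map_add_le_add q) _ _

/-- The Cesàro means of a sequence of period two converge. -/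
theorem tendsto_cesaro_of_period_two [LocallyConvexSpace ℝ E] {u : ℕ → E}
    (h : ∀ n, u (n + 2) = u n) :
    Tendsto (fun n : ℕ => (n : ℝ)⁻¹ • ∑ k ∈ Finset.Icc 1 n, u k) atTop
      (𝓝 ((2 : ℝ)⁻¹ • (u 0 + u 1))) := by
  set y := (2 : ℝ)⁻¹ • (u 0 + u 1) with hy
  have h2y : u 1 + u 0 = (2 : ℝ) • y := by
    rw [hy, smul_smul]
    norm_num
    exact add_comm _ _
  -- Consecutive pairs of terms add up to `2 • y`, so the `n`-th sum differs from `n • y` by an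
  -- error that depends only on the parity of `n`; division by `n` kills it.
  have hsum : ∀ n, ∑ k ∈ Finset.Icc 1 n, u k = (n : ℝ) • y ∨
      ∑ k ∈ Finset.Icc 1 n, u k = (n : ℝ) • y + (u 1 - y) := by
    have hu : ∀ m, u (2 * m) = u 0 ∧ u (2 * m + 1) = u 1 := by
      intro m
      induction m with
      | zero => simp
      | succ m ih => exact ⟨(h _).trans ih.1, (h (2 * m + 1)).trans ih.2⟩
    have hs : ∀ m, ∑ k ∈ Finset.Icc 1 (2 * m), u k = ((2 * m : ℕ) : ℝ) • y := by
      intro m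
      induction m with
      | zero => simp
      | succ m ih =>
        rw [show 2 * (m + 1) = 2 * m + 1 + 1 by ring, Finset.sum_Icc_succ_top (by omega),
          Finset.sum_Icc_succ_top (by omega), ih, (hu m).2, h, (hu m).1, add_assoc, h2y, ← add_smul]
        push_cast
        ring_nf
    intro n
    rcases Nat.even_or_odd' n with ⟨m, rfl | rfl⟩
    · exact .inl (hs m)
    · right
      rw [Finset.sum_Icc_succ_top (by omega), hs, (hu m).2]
      push_cast
      rw [add_smul, one_smul]
      abel
  refine tendsto_of_continuous_seminorm fun q hq => ?_
  have h1 : Tendsto (fun n : ℕ => (n : ℝ)⁻¹ * q (u 1 - y)) atTop (𝓝 0) := by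
    simpa using tendsto_inv_atTop_nhds_zero_nat.mul_const (q (u 1 - y))
  refine squeeze_zero' (.of_forall fun n => apply_nonneg q _) ?_ h1
  filter_upwards [eventually_gt_atTop 0] with n hn
  have hn' : (0 : ℝ) < n := by exact_mod_cast hn
  rcases hsum n with h3 | h3
  · rw [h3, smul_smul, inv_mul_cancel₀ hn'.ne', one_smul, sub_self, map_zero]
    positivity
  · rw [h3, smul_add, smul_smul, inv_mul_cancel₀ hn'.ne', one_smul, add_sub_cancel_left,
      map_smul_eq_mul, Real.norm_of_nonneg (by positivity)]

theorem convergesStrongly_iff {S : ℕ → E →L[ℝ] E} :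
    ConvergesStrongly S ↔ ∃ P : E →L[ℝ] E, ∀ x, Tendsto (fun n => S n x) atTop (𝓝 (P x)) := by
  constructor
  · rintro ⟨P, hP⟩
    exact ⟨⟨P.toLinearMap, P.cont⟩, PointwiseConvergenceCLM.tendsto_iff_forall_tendsto.1 hP⟩
  · rintro ⟨P, hP⟩
    exact ⟨ContinuousLinearMap.toPointwiseConvergenceCLM ℝ (RingHom.id ℝ) E E P,
      PointwiseConvergenceCLM.tendsto_iff_forall_tendsto.2 hP⟩

theorem isMeanErgodic_iff {T : E →L[ℝ] E} :
    IsMeanErgodic T ↔ ∃ P : E →L[ℝ] E, ∀ x,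
      Tendsto (fun n : ℕ => (n : ℝ)⁻¹ • ∑ k ∈ Finset.Icc 1 n, (T ^ k) x) atTop (𝓝 (P x)) := by
  simp [IsMeanErgodic, convergesStrongly_iff, cesaroMean]

end LocallyConvex

/-! ### Linear maps, seminorms and equicontinuity on locally convex inductive limits -/

section Inductive

variable {E : Type*} [AddCommGroup E] [Module ℝ E] {ι : Type*} {F : ι → Type*}
  [∀ i, TopologicalSpace (F i)] {j : ∀ i, F i → E}

/-- Continuity of a linear map on a locally convex inductive limit can be checked on the steps. -/
theorem continuous_of_inductiveTopology {G : Type*} [AddCommGroup G] [Module ℝ G]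
    [TopologicalSpace G] [IsTopologicalAddGroup G] [ContinuousSMul ℝ G] [LocallyConvexSpace ℝ G]
    (T : E →ₗ[ℝ] G) (h : ∀ i, Continuous fun f => T (j i f)) :
    @Continuous _ _ (inductiveTopology j) _ T := by
  -- The topology pulled back from `G` along `T` competes in the infimum that defines the inductive
  -- topology.
  rw [continuous_iff_le_induced]
  exact sInf_le ⟨fun i => continuous_induced_rng.2 (h i), topologicalAddGroup_induced _,
    continuousSMul_induced _, .induced _⟩

/-- Continuity of a seminorm on a locally convex inductive limit can be checked on the steps. -/
theorem seminorm_continuous_of_inductiveTopology (r : Seminorm ℝ E)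
    (h : ∀ i f₀, Tendsto (fun f => r (j i f - j i f₀)) (𝓝 f₀) (𝓝 0)) :
    @Continuous _ _ (inductiveTopology j) _ r := by
  -- The topology of the single seminorm `r` competes in the infimum too; competitors need not be
  -- Hausdorff.
  let p : SeminormFamily ℝ E Unit := fun _ => r
  let t : TopologicalSpace E := p.moduleFilterBasis.topology
  have hp : WithSeminorms p := ⟨rfl⟩
  have ht : inductiveTopology j ≤ t := by
    refine sInf_le ⟨fun i => ?_, hp.topologicalAddGroup, hp.continuousSMul,
      hp.toLocallyConvexSpace⟩
    rw [continuous_iff_continuousAt]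
    intro f₀
    rw [ContinuousAt, hp.tendsto_nhds]
    intro _ ε hε
    exact (h i f₀).eventually (gt_mem_nhds hε)
  exact continuous_le_dom ht (hp.continuous_seminorm ())

/-- Equicontinuity of a pointwise bounded family of linear maps on a locally convex inductive limit
can be checked on the steps. -/
theorem equicontinuous_of_inductiveTopology [t : TopologicalSpace E] [IsTopologicalAddGroup E]
    [ContinuousSMul ℝ E] [LocallyConvexSpace ℝ E] (ht : t = inductiveTopology j) {κ : Type*}
    (T : κ → E →ₗ[ℝ] E)
    (hb : ∀ x (q : Seminorm ℝ E), Continuous q → BddAbove (range fun n => q (T n x)))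
    (h : ∀ i f₀, Tendsto (fun q : κ × F i => T q.1 (j i q.2 - j i f₀)) (⊤ ×ˢ 𝓝 f₀) (𝓝 0)) :
    Tendsto (fun q : κ × E => T q.1 q.2) (⊤ ×ˢ 𝓝 0) (𝓝 0) := by
  refine tendsto_of_continuous_seminorm fun q hq => ?_
  simp only [sub_zero]
  have hbdd : BddAbove (range fun n => q.comp (T n)) :=
    Seminorm.bddAbove_range_iff.2 fun x => hb x q hq
  -- Finite everywhere by pointwise boundedness. Continuity of `r` controls all the `q (T n x)` at
  -- once; a supremum of continuous seminorms need not be continuous, but on the inductive limit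
  -- this can be tested on the steps.
  let r : Seminorm ℝ E := ⨆ n, q.comp (T n)
  have hr : ∀ x, r x = ⨆ n, q (T n x) := fun x => by
    simp only [r, Seminorm.iSup_apply hbdd, Seminorm.comp_apply]
  have hle : ∀ n x, q (T n x) ≤ r x := fun n x => by
    rw [hr]
    exact le_ciSup (hb x q hq) n
  have hrc : Continuous r := by
    rw [ht]
    -- The steps carry no linear structure, so every base point `f₀` is tested and differences are
    -- taken in `E`.
    refine seminorm_continuous_of_inductiveTopology r fun i f₀ => ?_
    rw [Metric.tendsto_nhds]
    intro ε hε
    have h1 := (hq.tendsto 0).comp (h i f₀)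
    rw [map_zero] at h1
    -- Half of `ε`, as the supremum over `n` turns strict bounds into weak ones.
    obtain ⟨A, hA, B, hB, hAB⟩ := mem_prod_iff.1
      (h1.eventually (gt_mem_nhds (half_pos hε)))
    filter_upwards [hB] with f hf
    rw [dist_zero_right, Real.norm_of_nonneg (apply_nonneg r _)]
    refine lt_of_le_of_lt ?_ (half_lt_self hε)
    rw [hr]
    refine Real.iSup_le (fun n => ?_) (half_pos hε).le
    exact (@hAB (n, f) ⟨by rw [mem_top.1 hA]; trivial, hf⟩).le
  have h2 : Tendsto (fun a : κ × E => r a.2) (⊤ ×ˢ 𝓝 0) (𝓝 0) := by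
    have := (hrc.tendsto 0).comp (tendsto_snd (f := (⊤ : Filter κ)) (g := 𝓝 (0 : E)))
    rwa [map_zero] at this
  exact squeeze_zero (fun _ => apply_nonneg q _) (fun a => hle a.1 a.2) h2

end Inductive

/-- A continuous map that vanishes on `K × {y}`, with `K` compact, is small near `y` uniformly
on `K`. -/
theorem tendsto_of_continuous_of_isCompact {A B Y κ : Type*} [TopologicalSpace A]
    [TopologicalSpace B] [TopologicalSpace Y] {K : Set A} (hK : IsCompact K) {y : B} {z : Y}
    {G : A × B → Y} (hG : Continuous G) (h0 : ∀ t ∈ K, G (t, y) = z) {s : κ → A}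
    (hs : ∀ n, s n ∈ K) :
    Tendsto (fun q : κ × B => G (s q.1, q.2)) (⊤ ×ˢ 𝓝 y) (𝓝 z) := by
  have h1 : Tendsto G (𝓝ˢ (K ×ˢ {y})) (𝓝ˢ {z}) := hG.tendsto_nhdsSet (by
    rintro ⟨t, b⟩ ⟨ht, rfl⟩
    exact h0 t ht)
  -- The tube lemma: neighbourhoods of `K ×ˢ {y}` contain products of neighbourhoods.
  rw [hK.nhdsSet_prod_eq isCompact_singleton, nhdsSet_singleton, nhdsSet_singleton] at h1
  refine h1.comp (Tendsto.prodMap ?_ tendsto_id)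
  exact (tendsto_principal.2 (.of_forall hs)).mono_right principal_le_nhdsSet

/-! ### Iterates of polynomials -/

/-- The iterates of an affine function with fixed point `p`. -/
theorem iterate_affine {φ : ℝ → ℝ} {p a : ℝ} (h : ∀ x, φ x = p + a * (x - p)) (n : ℕ) (x : ℝ) :
    φ^[n] x = p + a ^ n * (x - p) := by
  induction n with
  | zero => simp
  | succ n ih =>
    rw [Function.iterate_succ_apply', ih, h]
    ring

/-- The bound sustains itself: as `c ^ n ≥ 1`, it keeps the orbit of `R` in the region `R ≤ |x|`,
where the next application gains another factor `c`. -/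
theorem iterate_expanding {φ : ℝ → ℝ} {c R : ℝ} (hc : 1 < c) (hR : 1 ≤ R)
    (h : ∀ x, R ≤ |x| → c * |x| ≤ |φ x|) (n : ℕ) : c ^ n * R ≤ |φ^[n] R| := by
  induction n with
  | zero => simpa using le_abs_self R
  | succ n ih =>
    rw [Function.iterate_succ_apply']
    have h1 : R ≤ |φ^[n] R| := le_trans (by nlinarith [one_le_pow₀ hc.le (n := n)]) ih
    calc c ^ (n + 1) * R = c * (c ^ n * R) := by ring
      _ ≤ c * |φ^[n] R| := by gcongr
      _ ≤ _ := h _ h1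

/-- A polynomial of degree at least two is expanding near infinity. -/
theorem Polynomial.exists_expanding_of_two_le_natDegree {φ : Polynomial ℝ}
    (h : 2 ≤ φ.natDegree) : ∃ R : ℝ, 1 ≤ R ∧ ∀ x, R ≤ |x| → 2 * |x| ≤ |φ.eval x| := by
  -- Write `φ = divX * X + coeff 0` with `divX` nonconstant. For large `|x|` the first term is at
  -- least `3 * |x|` and the second at most `|x|`.
  have hd : 0 < φ.divX.degree := by
    rw [← Polynomial.natDegree_pos_iff_degree_pos, Polynomial.natDegree_divX_eq_natDegree_tsub_one]
    omega
  have h1 := Polynomial.tendsto_norm_atTop φ.divX hd (l := comap (fun x : ℝ => |x|) atTop)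
    (z := id) tendsto_comap
  obtain ⟨R, hR⟩ := eventually_atTop.1 (eventually_comap.1 (h1.eventually_ge_atTop 3))
  refine ⟨max 1 (max R |φ.coeff 0|), le_max_left _ _, fun x hx => ?_⟩
  have h2 : 3 ≤ |φ.divX.eval x| := hR |x| (by simp_all) x rfl
  have h3 : |φ.coeff 0| ≤ |x| := by simp_all
  have h4 := abs_sub_abs_le_abs_sub (φ.divX.eval x * x) (-φ.coeff 0)
  rw [abs_neg, abs_mul, sub_neg_eq_add] at h4
  have h5 : φ.eval x = φ.divX.eval x * x + φ.coeff 0 := by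
    conv_lhs => rw [← φ.divX_mul_X_add]
    simp
  rw [h5]
  nlinarith [mul_le_mul_of_nonneg_right h2 (abs_nonneg x)]

/-- If the squares of the iterates of a polynomial grow slower than `n` everywhere, then the
polynomial is an affine contraction, a reflection or the identity. -/
theorem Polynomial.affine_of_tendsto_iterate {φ : Polynomial ℝ}
    (h : ∀ x, Tendsto (fun n : ℕ => (n : ℝ)⁻¹ * ((fun y => φ.eval y)^[n] x) ^ 2) atTop (𝓝 0)) :
    ∃ a b : ℝ, φ = Polynomial.C a * Polynomial.X + Polynomial.C b ∧
      (|a| < 1 ∨ a = -1 ∨ (a = 1 ∧ b = 0)) := by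
  -- No orbit escapes linearly, since then `n⁻¹` times its square would be at least `n * δ ^ 2`.
  have key : ∀ x δ : ℝ, 0 < δ → ¬ ∀ n : ℕ, n * δ ≤ |(fun y => φ.eval y)^[n] x| := by
    intro x δ hδ hn
    have h1 : ∀ᶠ n : ℕ in atTop, δ ^ 2 ≤ (n : ℝ)⁻¹ * ((fun y => φ.eval y)^[n] x) ^ 2 := by
      filter_upwards [eventually_ge_atTop 1] with n hn1
      have hn1' : (1 : ℝ) ≤ n := by exact_mod_cast hn1
      rw [← sq_abs ((fun y => φ.eval y)^[n] x), ← div_eq_inv_mul, le_div_iff₀ (by linarith)]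
      calc δ ^ 2 * n ≤ δ ^ 2 * n * n := le_mul_of_one_le_right (by positivity) hn1'
        _ = (n * δ) ^ 2 := by ring
        _ ≤ _ := by gcongr; exact hn n
    have := ge_of_tendsto (h x) h1
    nlinarith [pow_pos hδ 2]
  -- Bernoulli's inequality `c ^ n ≥ 1 + n * (c - 1)` reduces exponential escape to linear escape.
  have hexp : ∀ c R : ℝ, 1 < c → 1 ≤ R → ¬ ∀ x, R ≤ |x| → c * |x| ≤ |φ.eval x| := by
    intro c R hc hR hx
    refine key R (c - 1) (by linarith) fun n => ?_
    refine le_trans ?_ (iterate_expanding hc hR hx n)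
    have h1 := one_add_mul_le_pow (a := c - 1) (by linarith) n
    rw [add_sub_cancel] at h1
    nlinarith [pow_pos (zero_lt_one.trans hc) n]
  have hdeg : φ.natDegree ≤ 1 := by
    by_contra! hd
    obtain ⟨R, hR, hx⟩ := Polynomial.exists_expanding_of_two_le_natDegree hd
    exact hexp 2 R (by norm_num) hR hx
  obtain ⟨a, b, rfl⟩ := Polynomial.exists_eq_X_add_C_of_natDegree_le_one hdeg
  refine ⟨a, b, rfl, ?_⟩
  simp only [Polynomial.eval_add, Polynomial.eval_mul, Polynomial.eval_C, Polynomial.eval_X]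
    at hexp key
  rcases lt_trichotomy |a| 1 with ha | ha | ha
  · exact .inl ha
  · rcases eq_or_eq_neg_of_abs_eq ha with rfl | rfl
    · right; right
      refine ⟨rfl, ?_⟩
      by_contra hb
      refine key 0 |b| (abs_pos.2 hb) fun n => ?_
      have : (fun y => 1 * y + b)^[n] 0 = n * b := by
        induction n with
        | zero => simp
        | succ n ih =>
          rw [Function.iterate_succ_apply', ih]
          push_cast
          ring
      rw [this, abs_mul, Nat.abs_cast]
    · exact .inr (.inl rfl)
  · exfalso
    -- The expansion factor is the midpoint of `1` and `|a|`. The remaining `(|a| - 1) / 2 * |x|`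
    -- absorbs `|b|` beyond this radius; the summand `1` ensures that the radius is at least one.
    refine hexp ((1 + |a|) / 2) (1 + |b| / ((|a| - 1) / 2)) (by linarith) ?_ fun x hx => ?_
    · have : 0 ≤ |b| / ((|a| - 1) / 2) := div_nonneg (abs_nonneg _) (by linarith)
      linarith
    · have h1 : |b| ≤ (|a| - 1) / 2 * |x| := by
        rw [mul_comm, ← div_le_iff₀ (by linarith)]
        linarith
      have h2 := abs_sub_abs_le_abs_sub (a * x) (-b)
      rw [abs_neg, abs_mul, sub_neg_eq_add] at h2
      linarith

/-! ### The mean ergodic theorem on an abstract contractive space -/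

namespace FunctionSpace

variable {X : FunctionSpace}

theorem Elem.ext {f g : X.Elem} (h : ∀ x, f.toFun x = g.toFun x) : f = g :=
  Subtype.ext (funext h)

/-- `X` is contractive: the dilations `f ↦ f (p + s n * (· - p))`, with `|s n| ≤ 1` and `s n → 0`,
are equicontinuous on `X` and converge to the evaluation at `p`. -/
def IsContractive (X : FunctionSpace) : Prop :=
  ∀ (p : ℝ) (s : ℕ → ℝ), (∀ n, s n ∈ Icc (-1 : ℝ) 1) → Tendsto s atTop (𝓝 0) →
    ∀ T : ℕ → X.Elem →ₗ[ℝ] X.Elem, (∀ n f x, (T n f).toFun x = f.toFun (p + s n * (x - p))) →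
      (∀ f g : X.Elem, (∀ x, g.toFun x = f.toFun p) → Tendsto (fun n => T n f) atTop (𝓝 g)) ∧
      Tendsto (fun q : ℕ × X.Elem => T q.1 q.2) (⊤ ×ˢ 𝓝 0) (𝓝 0)

theorem compositionOperator_pow_toFun {φ : ℝ → ℝ} (h : X.IsSymbol φ) (n : ℕ) (f : X.Elem) (x : ℝ) :
    ((compositionOperator h ^ n) f).toFun x = f.toFun (φ^[n] x) := by
  induction n generalizing x with
  | zero => rfl
  | succ n ih =>
    rw [pow_succ', Function.iterate_succ_apply]
    exact ih (φ x)

theorem compositionOperator_iterate {φ : ℝ → ℝ} (h : X.IsSymbol φ) (n : ℕ) :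
    compositionOperator (h.iterate n) = compositionOperator h ^ n := by
  ext f
  exact Elem.ext fun x => (compositionOperator_pow_toFun h n f x).symm

/-- The mean ergodic theorem for polynomial composition operators on a contractive space with
continuous point evaluations that contains the constants and the square function. -/
theorem meanErgodic_iff_of_isContractive (φ : Polynomial ℝ) (h : X.IsSymbol fun x => φ.eval x)
    (heval : ∀ x, Continuous fun f : X.Elem => f.toFun x)
    (hone : (fun _ => 1 : ℝ → ℝ) ∈ X.toSubmodule) (hsq : (fun x => x ^ 2 : ℝ → ℝ) ∈ X.toSubmodule)
    (hX : X.IsContractive) :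
    (IsMeanErgodic (compositionOperator h) ↔ IsPowerBounded (compositionOperator h)) ∧
      (IsPowerBounded (compositionOperator h) ↔
        ∃ a b : ℝ, φ = Polynomial.C a * Polynomial.X + Polynomial.C b ∧
          (|a| < 1 ∨ a = -1 ∨ (a = 1 ∧ b = 0))) ∧
      ∀ a b : ℝ, φ = Polynomial.C a * Polynomial.X + Polynomial.C b → |a| < 1 →
        ConvergesStrongly fun n : ℕ => compositionOperator (h.iterate n) := by
  set C := compositionOperator h with hC
  have hpow := compositionOperator_pow_toFun h
  rw [← hC] at hpow
  have hit : (fun n : ℕ => compositionOperator (h.iterate n)) = fun n => C ^ n :=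
    funext fun n => compositionOperator_iterate h n
  rw [hit]
  have hme : IsMeanErgodic C → ∃ a b : ℝ, φ = Polynomial.C a * Polynomial.X + Polynomial.C b ∧
      (|a| < 1 ∨ a = -1 ∨ (a = 1 ∧ b = 0)) := by
    rw [isMeanErgodic_iff]
    rintro ⟨P, hP⟩
    refine Polynomial.affine_of_tendsto_iterate fun x => ?_
    let e : X.Elem →ₗ[ℝ] ℝ := ⟨⟨fun f => f.toFun x, fun _ _ => rfl⟩, fun _ _ => rfl⟩
    have h1 := ((heval x).tendsto _).comp (hP (Elem.mk _ hsq))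
    have h2 : ∀ n : ℕ, e ((n : ℝ)⁻¹ • ∑ k ∈ Finset.Icc 1 n, (C ^ k) (Elem.mk _ hsq))
        = (n : ℝ)⁻¹ * ∑ k ∈ Finset.Icc 1 n, ((fun y => φ.eval y)^[k] x) ^ 2 := by
      intro n
      rw [map_smul, map_sum, smul_eq_mul]
      congr 1
      exact Finset.sum_congr rfl fun k _ => hpow k _ x
    have h3 := h1.congr h2
    set v : ℕ → ℝ := fun k => ((fun y => φ.eval y)^[k] x) ^ 2
    set L := (P (Elem.mk _ hsq)).toFun x
    -- With `M n` the Cesàro means of `v`, `v (n + 1) / (n + 1) = M (n + 1) - n / (n + 1) * M n`,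
    -- which tends to `L - L`.
    have h4 : Tendsto (fun n : ℕ => ((n + 1 : ℕ) : ℝ)⁻¹ * v (n + 1)) atTop (𝓝 0) := by
      have h5 := h3.comp (tendsto_add_atTop_nat 1)
      have h6 : Tendsto (fun n : ℕ => (n : ℝ) / (n + 1)) atTop (𝓝 1) :=
        tendsto_natCast_div_add_atTop 1
      have h7 := h5.sub (h6.mul h3)
      rw [one_mul, sub_self] at h7
      refine h7.congr' ?_
      filter_upwards [eventually_gt_atTop 0] with n hn
      have hn' : (n : ℝ) ≠ 0 := by exact_mod_cast hn.ne'
      have hn'' : (n : ℝ) + 1 ≠ 0 := by positivity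
      simp only [Function.comp_apply]
      rw [Finset.sum_Icc_succ_top (by omega)]
      push_cast
      field_simp
      ring
    exact (tendsto_add_atTop_iff_nat 1).1 h4
  have hpb : IsPowerBounded C → ∃ a b : ℝ, φ = Polynomial.C a * Polynomial.X + Polynomial.C b ∧
      (|a| < 1 ∨ a = -1 ∨ (a = 1 ∧ b = 0)) := by
    rw [isPowerBounded_iff]
    intro hT
    refine Polynomial.affine_of_tendsto_iterate fun x => ?_
    have h1 := ((heval x).tendsto 0).comp hT
    obtain ⟨A, hA, B, hB, hAB⟩ := mem_prod_iff.1 (h1 (Metric.ball_mem_nhds _ one_pos))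
    let g : X.Elem := Elem.mk _ hsq
    -- On `B` all powers have values of modulus less than one at `x`; a small multiple `ε • g` of
    -- the square function lies in `B`, so the squared orbit is bounded by `ε⁻¹`.
    have h2 : ∀ᶠ ε : ℝ in 𝓝 0, ε • g ∈ B := by
      have : Tendsto (fun ε : ℝ => ε • g) (𝓝 0) (𝓝 0) := by
        have := (tendsto_id (x := 𝓝 (0 : ℝ))).smul_const g
        rwa [zero_smul] at this
      exact this hB
    obtain ⟨ε, hεB, hε⟩ := ((h2.filter_mono nhdsWithin_le_nhds).and
      (self_mem_nhdsWithin (a := (0 : ℝ)) (s := Ioi 0))).exists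
    have hε : 0 < ε := hε
    have h3 : ∀ n, ((fun y => φ.eval y)^[n] x) ^ 2 ≤ ε⁻¹ := by
      intro n
      have h4 := @hAB (n, ε • g) ⟨by rw [mem_top.1 hA]; trivial, hεB⟩
      have h5 : ((C ^ n) (ε • g)).toFun x = ε * ((fun y => φ.eval y)^[n] x) ^ 2 := hpow n _ x
      have h6 : (0 : X.Elem).toFun x = 0 := rfl
      simp only [mem_preimage, Function.comp_apply, h5, h6, mem_ball_zero_iff, Real.norm_eq_abs] at h4
      have h7 := (le_abs_self _).trans h4.le
      rwa [← one_div, le_div_iff₀' hε]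
    refine squeeze_zero (fun n => by positivity) (fun n => mul_le_mul_of_nonneg_left (h3 n)
      (by positivity)) ?_
    simpa using tendsto_inv_atTop_nhds_zero_nat.mul_const ε⁻¹
  have hcontr : ∀ a b : ℝ, φ = Polynomial.C a * Polynomial.X + Polynomial.C b → |a| < 1 →
      (∃ Q : X.Elem →L[ℝ] X.Elem, ∀ f, Tendsto (fun n => (C ^ n) f) atTop (𝓝 (Q f))) ∧
      IsPowerBounded C := by
    rintro a b rfl ha
    have ha1 : 1 - a ≠ 0 := by linarith [le_abs_self a]
    -- The fixed point of the affine contraction.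
    set p := b / (1 - a) with hp
    have hφ : ∀ x, (Polynomial.C a * Polynomial.X + Polynomial.C b).eval x = p + a * (x - p) := by
      intro x
      simp only [Polynomial.eval_add, Polynomial.eval_mul, Polynomial.eval_C, Polynomial.eval_X, hp]
      field_simp
      ring
    have h1 := hX p (fun n => a ^ n) (fun n => by
      rw [mem_Icc, ← abs_le, abs_pow]
      exact pow_le_one₀ (abs_nonneg a) ha.le) (tendsto_pow_atTop_nhds_zero_of_abs_lt_one ha)
      (fun n => ((C ^ n : X.Elem →L[ℝ] X.Elem) : X.Elem →ₗ[ℝ] X.Elem)) (fun n f x => by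
        rw [← iterate_affine hφ n x]
        exact hpow n f x)
    -- The limit is the rank one operator `f ↦ f p • 1`, continuous because evaluation at `p` is.
    refine ⟨⟨⟨⟨⟨fun f => f.toFun p • Elem.mk _ hone, fun f g => ?_⟩, fun c f => ?_⟩, ?_⟩,
      fun f => ?_⟩, isPowerBounded_iff.2 h1.2⟩
    · exact add_smul (f.toFun p) (g.toFun p) _
    · exact mul_smul c (f.toFun p) _
    · exact (heval p).smul continuous_const
    · refine h1.1 f _ fun x => ?_
      exact mul_one (f.toFun p)
  have hrefl : (∀ n f, (C ^ (n + 2)) f = (C ^ n) f) → IsMeanErgodic C ∧ IsPowerBounded C := by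
    intro h2
    refine ⟨isMeanErgodic_iff.2 ⟨(2 : ℝ)⁻¹ • (C ^ 0 + C ^ 1), fun f =>
      tendsto_cesaro_of_period_two fun n => h2 n f⟩, ?_⟩
    rw [isPowerBounded_iff]
    intro V hV
    have h0 : ∀ n, ∀ᶠ f in 𝓝 (0 : X.Elem), (C ^ n) f ∈ V := fun n => by
      have := (C ^ n).continuous.tendsto 0
      rw [map_zero] at this
      exact this hV
    rw [mem_map, mem_prod_iff]
    -- Every power equals the zeroth or the first, so a neighbourhood that serves both serves all.
    refine ⟨univ, by simp, _, (h0 0).and (h0 1), ?_⟩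
    rintro ⟨n, f⟩ ⟨-, hf⟩
    have : ∀ n, (C ^ n) f ∈ V ∧ (C ^ (n + 1)) f ∈ V := by
      intro n
      induction n with
      | zero => exact hf
      | succ n ih => exact ⟨ih.2, by rw [h2]; exact ih.1⟩
    exact (this n).1
  have hback : (∃ a b : ℝ, φ = Polynomial.C a * Polynomial.X + Polynomial.C b ∧
      (|a| < 1 ∨ a = -1 ∨ (a = 1 ∧ b = 0))) → IsMeanErgodic C ∧ IsPowerBounded C := by
    rintro ⟨a, b, hab, ha | ha⟩
    · obtain ⟨⟨Q, hQ⟩, hp⟩ := hcontr a b hab ha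
      exact ⟨isMeanErgodic_iff.2 ⟨Q, fun f => tendsto_cesaro_of_locallyConvex (hQ f)⟩, hp⟩
    · refine hrefl fun n f => Elem.ext fun x => ?_
      rw [hpow, hpow, Function.iterate_add_apply]
      -- Both `x ↦ b - x` and the identity are involutions.
      congr 2
      rcases ha with rfl | ⟨rfl, rfl⟩ <;> simp [hab]
  exact ⟨⟨fun h1 => (hback (hme h1)).2, fun h1 => (hback (hpb h1)).1⟩,
    ⟨hpb, fun h1 => (hback h1).2⟩, fun a b hab ha => convergesStrongly_iff.2 (hcontr a b hab ha).1⟩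

end FunctionSpace

/-! ### Derivatives of compositions with polynomials -/

theorem iteratedDeriv_dilation {i : ℕ} {f : ℝ → ℝ} (hf : ContDiff ℝ i f) (p t x : ℝ) :
    iteratedDeriv i (fun x => f (p + t * (x - p))) x
      = t ^ i * iteratedDeriv i f (p + t * (x - p)) := by
  -- The dilation splits into scaling by `t` followed by translation by `p - t * p`; only the
  -- scaling contributes a factor.
  have h1 : ContDiff ℝ i fun y => f (p - t * p + y) := hf.comp (contDiff_const.add contDiff_id)
  have h2 := congrFun (iteratedDeriv_comp_const_mul h1 t) x
  rw [iteratedDeriv_comp_const_add] at h2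
  rw [show p + t * (x - p) = p - t * p + t * x by ring, ← h2]
  congr 1
  ext y
  ring_nf

/-- The derivatives of `f ∘ φ` are combinations of those of `f` at `φ x` with polynomial
coefficients. -/
theorem exists_iteratedDeriv_comp_polynomial (φ : Polynomial ℝ) (i : ℕ) :
    ∃ P : ℕ → Polynomial ℝ, ∀ f : ℝ → ℝ, ContDiff ℝ i f → ∀ x,
      iteratedDeriv i (f ∘ fun x => φ.eval x) x
        = ∑ k ∈ Finset.range (i + 1), (P k).eval x * iteratedDeriv k f (φ.eval x) := by
  induction i with
  | zero => exact ⟨fun _ => 1, fun f _ x => by simp⟩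
  | succ i ih =>
    obtain ⟨P, hP⟩ := ih
    -- The product and chain rules give the recursion `P k' + P (k - 1) * φ'`. The cases impose the
    -- value zero outside `0 ≤ k ≤ i`, where the induction hypothesis says nothing about `P`.
    refine ⟨fun k => (if k < i + 1 then (P k).derivative else 0) +
      (if k = 0 then 0 else P (k - 1) * φ.derivative), fun f hf x => ?_⟩
    rw [iteratedDeriv_succ, funext (hP f (hf.of_le (by norm_cast; omega)))]
    have h1 : ∀ k ∈ Finset.range (i + 1),
        HasDerivAt (fun x => (P k).eval x * iteratedDeriv k f (φ.eval x))
          ((P k).derivative.eval x * iteratedDeriv k f (φ.eval x) +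
            (P k).eval x * (iteratedDeriv (k + 1) f (φ.eval x) * φ.derivative.eval x)) x := by
      intro k hk
      have hk : k < i + 1 := Finset.mem_range.1 hk
      have hd : HasDerivAt (iteratedDeriv k f) (iteratedDeriv (k + 1) f (φ.eval x))
          (φ.eval x) := by
        rw [iteratedDeriv_succ]
        exact ((hf.differentiable_iteratedDeriv k (by exact_mod_cast hk)) _).hasDerivAt
      have hc := hd.comp x (φ.hasDerivAt x)
      exact ((P k).hasDerivAt x).mul hc
    rw [(HasDerivAt.fun_sum h1).deriv, Finset.sum_add_distrib]
    simp only [Polynomial.eval_add, add_mul, Finset.sum_add_distrib]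
    congr 1
    · rw [Finset.sum_range_succ _ (i + 1)]
      simp only [lt_irrefl, if_false, Polynomial.eval_zero, zero_mul, add_zero]
      exact Finset.sum_congr rfl fun k hk => by rw [if_pos (Finset.mem_range.1 hk)]
    · rw [Finset.sum_range_succ' _ (i + 1)]
      simp only [if_true, Polynomial.eval_zero, zero_mul, add_zero, Nat.succ_ne_zero, if_false,
        add_tsub_cancel_right, Polynomial.eval_mul]
      exact Finset.sum_congr rfl fun k hk => by ring

theorem Polynomial.contDiff_eval (φ : Polynomial ℝ) (m : WithTop ℕ∞) :
    ContDiff ℝ m fun x => φ.eval x := by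
  simpa [Polynomial.coe_aeval_eq_eval] using φ.contDiff_aeval (𝕜 := ℝ) (R := ℝ) m

/-- The affine maps `x ↦ p + t * (x - p)`, as continuous functions. -/
def dilation (p t : ℝ) : C(ℝ, ℝ) := ⟨fun x => p + t * (x - p), by fun_prop⟩

theorem continuous_dilation (p : ℝ) : Continuous (dilation p) :=
  ContinuousMap.continuous_of_continuous_uncurry _
    (by simp only [Function.uncurry_def, dilation, ContinuousMap.coe_mk]; fun_prop)

/-! ### The spaces `C^m(ℝ)` -/

namespace smoothSpace

variable {m : ℕ∞}

/-- The `i`-th derivative as a linear map on `C^m(ℝ)`. -/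
noncomputable def derivMap (m : ℕ∞) (i : ℕ) (hi : (i : ℕ∞) ≤ m) :
    (smoothSpace m).Elem →ₗ[ℝ] C(ℝ, ℝ) :=
  smoothDeriv m i hi

theorem derivMap_apply (i : ℕ) (hi : (i : ℕ∞) ≤ m) (f : (smoothSpace m).Elem) (x : ℝ) :
    derivMap m i hi f x = iteratedDeriv i f.toFun x :=
  rfl

theorem contDiff_toFun (f : (smoothSpace m).Elem) : ContDiff ℝ m f.toFun := f.2

theorem continuous_derivMap (i : ℕ) (hi : (i : ℕ∞) ≤ m) :
    Continuous fun f : (smoothSpace m).Elem => derivMap m i hi f :=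
  continuous_iff_le_induced.2 (iInf_le _ (⟨i, hi⟩ : {i : ℕ // (i : ℕ∞) ≤ m}))

theorem tendsto_iff {α : Type*} {l : Filter α} {u : α → (smoothSpace m).Elem}
    {g : (smoothSpace m).Elem} :
    Tendsto u l (𝓝 g) ↔ ∀ (i : ℕ) (hi : (i : ℕ∞) ≤ m),
      Tendsto (fun a => derivMap m i hi (u a)) l (𝓝 (derivMap m i hi g)) := by
  have h : 𝓝 g = ⨅ i : {i : ℕ // (i : ℕ∞) ≤ m},
      comap (derivMap m i.1 i.2) (𝓝 (derivMap m i.1 i.2 g)) := by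
    refine (nhds_iInf (a := (g : smoothSubmodule m))).trans (iInf_congr fun i => ?_)
    exact nhds_induced _ _
  rw [h, tendsto_iInf]
  simp only [Filter.tendsto_comap_iff, Subtype.forall]
  rfl

theorem continuous_eval (x : ℝ) : Continuous fun f : (smoothSpace m).Elem => f.toFun x := by
  have := (ContinuousEvalConst.continuous_eval_const (F := C(ℝ, ℝ)) x).comp
    (continuous_derivMap (m := m) 0 (by simp))
  simpa only [Function.comp_def, derivMap_apply, iteratedDeriv_zero] using this

/-- Each derivative of `f ∘ φ` is a finite sum of fixed continuous functions times derivatives of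
`f` precomposed with `φ`, and these operations are continuous for the compact-open topology. -/
theorem isSymbol (m : ℕ∞) (φ : Polynomial ℝ) : (smoothSpace m).IsSymbol fun x => φ.eval x := by
  have hmem : ∀ f ∈ (smoothSpace m).toSubmodule,
      f ∘ (fun x => φ.eval x) ∈ (smoothSpace m).toSubmodule :=
    fun f hf => ContDiff.comp (n := m) (g := f) hf (φ.contDiff_eval m)
  refine ⟨hmem, ?_⟩
  rw [continuous_iff_continuousAt]
  intro g
  rw [ContinuousAt, tendsto_iff]
  intro i hi
  obtain ⟨P, hP⟩ := exists_iteratedDeriv_comp_polynomial φ i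
  let c : C(ℝ, ℝ) := ⟨fun x => φ.eval x, φ.continuous⟩
  have hk : ∀ k : Fin (i + 1), ((k : ℕ) : ℕ∞) ≤ m := fun k =>
    le_trans (by exact_mod_cast Nat.lt_succ_iff.1 k.2) hi
  have h1 : ∀ (f : (smoothSpace m).Elem)
      (hf : f.toFun ∘ (fun x => φ.eval x) ∈ (smoothSpace m).toSubmodule),
      derivMap m i hi (FunctionSpace.Elem.mk _ hf) = ∑ k : Fin (i + 1),
        (⟨fun x => (P k).eval x, (P k).continuous⟩ : C(ℝ, ℝ)) *
          (derivMap m k (hk k) f).comp c := by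
    intro f hf
    ext x
    refine (hP f.toFun ((contDiff_toFun f).of_le (by exact_mod_cast hi)) x).trans ?_
    rw [Finset.sum_range, ContinuousMap.sum_apply]
    rfl
  simp only [h1]
  refine Continuous.tendsto (continuous_finsetSum _ fun k _ => continuous_const.mul ?_) g
  exact (ContinuousMap.continuous_precomp c).comp (continuous_derivMap k (hk k))

theorem derivMap_dilation {f g : (smoothSpace m).Elem} {p t : ℝ}
    (h : ∀ x, g.toFun x = f.toFun (p + t * (x - p))) (i : ℕ) (hi : (i : ℕ∞) ≤ m) :
    derivMap m i hi g = t ^ i • (derivMap m i hi f).comp (dilation p t) := by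
  ext x
  have hf : ContDiff ℝ i f.toFun := (contDiff_toFun f).of_le
    (by exact_mod_cast hi)
  have h1 := iteratedDeriv_dilation hf p t x
  rw [← funext h] at h1
  exact h1

/-- The `i`-th derivative of a dilated function is `t ^ i` times the dilated derivative, jointly
continuous in `t` and `f`. Letting `t` tend to `0` gives the limit, and compactness of `[-1, 1]`
gives equicontinuity. -/
theorem isContractive (m : ℕ∞) : (smoothSpace m).IsContractive := by
  intro p s hs hs0 T hT
  have hG : ∀ (i : ℕ) (hi : (i : ℕ∞) ≤ m), Continuous fun q : ℝ × (smoothSpace m).Elem =>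
      q.1 ^ i • (derivMap m i hi q.2).comp (dilation p q.1) := fun i hi =>
    (continuous_fst.pow i).smul (((continuous_derivMap i hi).comp continuous_snd).compCM
      ((continuous_dilation p).comp continuous_fst))
  refine ⟨fun f g hg => tendsto_iff.2 fun i hi => ?_, tendsto_iff.2 fun i hi => ?_⟩
  · simp only [fun n => derivMap_dilation (hT n f) i hi]
    -- The constant limit is itself the dilation with factor `0`.
    rw [derivMap_dilation (f := f) (g := g) (p := p) (t := 0) (by simpa using hg) i hi]
    exact ((hG i hi).tendsto (0, f)).comp (hs0.prodMk_nhds tendsto_const_nhds)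
  · simp only [fun n f => derivMap_dilation (hT n f) i hi]
    refine tendsto_of_continuous_of_isCompact isCompact_Icc (hG i hi) (fun t _ => ?_) hs
    have : derivMap m i hi (0 : (smoothSpace m).Elem) = 0 := map_zero (derivMap m i hi)
    rw [this]
    ext x
    simp

end smoothSpace

/-! ### The spaces `𝒪^m(ℝ)` and `𝒪_M(ℝ)` -/

theorem Polynomial.exists_abs_eval_le (P : Polynomial ℝ) :
    ∃ (C : ℝ) (k : ℕ), 0 ≤ C ∧ ∀ x, |P.eval x| ≤ C * (1 + x ^ 2) ^ k := by
  induction P using Polynomial.induction_on' with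
  | add P Q hP hQ =>
    obtain ⟨C, k, hC, hP⟩ := hP
    obtain ⟨D, l, hD, hQ⟩ := hQ
    refine ⟨C + D, max k l, by positivity, fun x => ?_⟩
    have h1 : 1 ≤ 1 + x ^ 2 := by nlinarith [sq_nonneg x]
    rw [Polynomial.eval_add, add_mul]
    refine (abs_add_le _ _).trans (add_le_add ((hP x).trans ?_) ((hQ x).trans ?_))
    · gcongr
      exact le_max_left _ _
    · gcongr
      exact le_max_right _ _
  | monomial n a =>
    refine ⟨|a|, n, abs_nonneg a, fun x => ?_⟩
    rw [Polynomial.eval_monomial, abs_mul, abs_pow]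
    have : |x| ≤ 1 + x ^ 2 := by
      rw [← sq_abs]
      nlinarith [sq_nonneg (|x| - 1)]
    gcongr

theorem Polynomial.exists_one_add_sq_eval_le (P : Polynomial ℝ) :
    ∃ (C : ℝ) (k : ℕ), 0 ≤ C ∧ ∀ x, 1 + P.eval x ^ 2 ≤ C * (1 + x ^ 2) ^ k := by
  obtain ⟨C, k, hC, h⟩ := Polynomial.exists_abs_eval_le (1 + P ^ 2)
  refine ⟨C, k, hC, fun x => ?_⟩
  have := (le_abs_self _).trans (h x)
  simpa using this

namespace GrowthStep

variable {m n : ℕ}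

theorem norm_le {f : GrowthStep m n} {K : ℝ} (hK : 0 ≤ K)
    (h : ∀ i ≤ m, ∀ x, |iteratedDeriv i f.1 x| ≤ K * (1 + x ^ 2) ^ n) : ‖f‖ ≤ K := by
  rw [norm_def]
  refine Real.iSup_le (fun q => ?_) hK
  rw [div_le_iff₀ (by positivity)]
  exact h q.1 (Nat.lt_succ_iff.1 q.1.2) q.2

theorem abs_iteratedDeriv_le (f : GrowthStep m n) {i : ℕ} (hi : i ≤ m) (x : ℝ) :
    |iteratedDeriv i f.1 x| ≤ ‖f‖ * (1 + x ^ 2) ^ n := by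
  have h := le_ciSup f.bddAbove (⟨i, Nat.lt_succ_iff.2 hi⟩, x)
  rwa [← norm_def, div_le_iff₀ (by positivity)] at h

theorem contDiff (f : GrowthStep m n) {i : ℕ} (hi : i ≤ m) : ContDiff ℝ i f.1 :=
  f.2.1.of_le (by exact_mod_cast hi)

/-- A function with bounds on its derivatives, as an element of `𝒪^m_n(ℝ)`. -/
def mk (f : ℝ → ℝ) (hf : ContDiff ℝ m f) (K : ℝ)
    (h : ∀ i ≤ m, ∀ x, |iteratedDeriv i f x| ≤ K * (1 + x ^ 2) ^ n) : GrowthStep m n :=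
  ⟨f, hf, K, fun i hi x => (div_le_iff₀ (by positivity)).2 (h i hi x)⟩

/-- Both the polynomial coefficients of the chain rule and `1 + φ ^ 2` grow at most like a power of
`1 + x ^ 2`. As `C` and `N` do not depend on `f`, composition is bounded from one step to a later
one. -/
theorem exists_comp_polynomial_le (φ : Polynomial ℝ) (m n : ℕ) :
    ∃ (C : ℝ) (N : ℕ), 0 ≤ C ∧ ∀ f : GrowthStep m n, ∀ i ≤ m, ∀ x,
      |iteratedDeriv i (f.1 ∘ fun x => φ.eval x) x| ≤ C * ‖f‖ * (1 + x ^ 2) ^ N := by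
  choose P hP using exists_iteratedDeriv_comp_polynomial φ
  choose C k hC hCk using fun i j => (P i j).exists_abs_eval_le
  obtain ⟨D, l, hD, hDl⟩ := φ.exists_one_add_sq_eval_le
  -- Sums of nonnegative terms serve as crude upper bounds for all `C i j` and `k i j` at once.
  let A := ∑ i ∈ Finset.range (m + 1), ∑ j ∈ Finset.range (m + 1), C i j
  let B := ∑ i ∈ Finset.range (m + 1), ∑ j ∈ Finset.range (m + 1), k i j
  refine ⟨A * D ^ n, B + l * n, mul_nonneg (Finset.sum_nonneg fun i _ =>
    Finset.sum_nonneg fun j _ => hC i j) (by positivity), fun f i hi x => ?_⟩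
  have h1 : 1 ≤ 1 + x ^ 2 := by nlinarith [sq_nonneg x]
  have hi' : i ∈ Finset.range (m + 1) := Finset.mem_range.2 (by omega)
  rw [hP i f.1 (f.contDiff hi)]
  calc |∑ j ∈ Finset.range (i + 1), (P i j).eval x * iteratedDeriv j f.1 (φ.eval x)|
      ≤ ∑ j ∈ Finset.range (i + 1), C i j * ((1 + x ^ 2) ^ B *
          (‖f‖ * (D * (1 + x ^ 2) ^ l) ^ n)) := by
        refine (Finset.abs_sum_le_sum_abs _ _).trans (Finset.sum_le_sum fun j hj => ?_)
        have hj : j < i + 1 := Finset.mem_range.1 hj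
        have hk : k i j ≤ B :=
          (Finset.single_le_sum (f := fun j => k i j) (fun _ _ => Nat.zero_le _)
            (Finset.mem_range.2 (by omega : j < m + 1))).trans
          (Finset.single_le_sum (f := fun i => ∑ j ∈ Finset.range (m + 1), k i j)
            (fun _ _ => Nat.zero_le _) hi')
        rw [abs_mul, ← mul_assoc]
        gcongr
        · exact mul_nonneg (hC i j) (by positivity)
        · exact (hCk i j x).trans (mul_le_mul_of_nonneg_left (pow_le_pow_right₀ h1 hk) (hC i j))
        · refine (f.abs_iteratedDeriv_le (by omega) _).trans ?_
          gcongr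
          exact hDl x
    _ = (∑ j ∈ Finset.range (i + 1), C i j) * ((1 + x ^ 2) ^ B *
          (‖f‖ * (D * (1 + x ^ 2) ^ l) ^ n)) := by rw [Finset.sum_mul]
    _ ≤ A * ((1 + x ^ 2) ^ B * (‖f‖ * (D * (1 + x ^ 2) ^ l) ^ n)) := by
        gcongr
        refine (Finset.sum_le_sum_of_subset_of_nonneg (t := Finset.range (m + 1)) ?_
          fun j _ _ => hC i j).trans ?_
        · exact Finset.range_subset_range.2 (by omega)
        · exact Finset.single_le_sum (f := fun i => ∑ j ∈ Finset.range (m + 1), C i j)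
            (fun i _ => Finset.sum_nonneg fun j _ => hC i j) hi'
    _ = A * D ^ n * ‖f‖ * (1 + x ^ 2) ^ (B + l * n) := by
        rw [mul_pow, ← pow_mul, pow_add]
        ring

/-- Dilations map `𝒪^m_n(ℝ)` to itself boundedly. -/
theorem exists_dilation_le (m n : ℕ) (p : ℝ) :
    ∃ C : ℝ, 0 ≤ C ∧ ∀ t ∈ Icc (-1 : ℝ) 1, ∀ f : GrowthStep m n, ∀ i ≤ m, ∀ x,
      |iteratedDeriv i f.1 (p + t * (x - p))| ≤ C * ‖f‖ * (1 + x ^ 2) ^ n := by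
  refine ⟨(2 + 8 * p ^ 2) ^ n, by positivity, fun t ht f i hi x => ?_⟩
  refine (f.abs_iteratedDeriv_le hi _).trans ?_
  -- From `(p + y) ^ 2 ≤ 2 * p ^ 2 + 2 * y ^ 2` with `y ^ 2 ≤ (x - p) ^ 2`; the constant leaves room
  -- for the cross term `-4 * p * x`.
  have h1 : 1 + (p + t * (x - p)) ^ 2 ≤ (2 + 8 * p ^ 2) * (1 + x ^ 2) := by
    have h2 : t ^ 2 ≤ 1 := (sq_le_one_iff_abs_le_one t).2 (abs_le.2 ht)
    have h3 : t ^ 2 * (x - p) ^ 2 ≤ 1 * (x - p) ^ 2 := by gcongr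
    nlinarith [sq_nonneg (p - t * (x - p)), sq_nonneg (x + p), sq_nonneg (x * p), sq_nonneg x,
      sq_nonneg p]
  calc ‖f‖ * (1 + (p + t * (x - p)) ^ 2) ^ n
      ≤ ‖f‖ * ((2 + 8 * p ^ 2) * (1 + x ^ 2)) ^ n := by gcongr
    _ = _ := by rw [mul_pow]; ring

end GrowthStep

namespace slowSpace

variable {m : ℕ}

/-- The inclusion of `𝒪^m_n(ℝ)` into `𝒪^m(ℝ)`, as a linear map. -/
noncomputable def incl (m n : ℕ) : GrowthStep m n →ₗ[ℝ] (slowSpace m).Elem where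
  toFun f := GrowthStep.incl m n f
  map_add' _ _ := rfl
  map_smul' _ _ := rfl

theorem continuous_incl (m n : ℕ) : Continuous (incl m n) :=
  inductiveTopology_continuous (GrowthStep.incl m) n

theorem top_eq (m : ℕ) :
    (slowSpace m).instTopologicalSpaceElem = inductiveTopology fun n => incl m n :=
  rfl

theorem exists_incl (f : (slowSpace m).Elem) : ∃ n g, incl m n g = f := by
  obtain ⟨n, hn⟩ := mem_iUnion.1 f.2
  exact ⟨n, ⟨f.1, hn⟩, rfl⟩

theorem le_pointwise (m : ℕ) : (slowSpace m).top ≤ instTopologicalSpaceSubtype :=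
  inductiveTopology_le_pointwise _ fun _ x => GrowthStep.continuous_eval x

theorem continuous_eval (x : ℝ) : Continuous fun f : (slowSpace m).Elem => f.toFun x := by
  have h : Continuous fun f : (slowSpace m).Elem => f.toFun :=
    continuous_iff_le_induced.2 (le_pointwise m)
  exact (continuous_apply x).comp h

theorem isSymbol (m : ℕ) (φ : Polynomial ℝ) : (slowSpace m).IsSymbol fun x => φ.eval x := by
  have hstep : ∀ n, ∃ (N : ℕ) (A : GrowthStep m n →+ GrowthStep m N), Continuous A ∧
      ∀ f, (A f).1 = f.1 ∘ fun x => φ.eval x := by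
    intro n
    obtain ⟨C, N, hC, h⟩ := GrowthStep.exists_comp_polynomial_le φ m n
    let A : GrowthStep m n →+ GrowthStep m N :=
      { toFun := fun f => .mk _ ((f.contDiff le_rfl).comp (φ.contDiff_eval m)) (C * ‖f‖) (h f)
        map_zero' := rfl
        map_add' := fun _ _ => rfl }
    exact ⟨N, A, AddMonoidHomClass.continuous_of_bound A C fun f =>
      GrowthStep.norm_le (by positivity) (h f), fun f => rfl⟩
  choose N A hA hAφ using hstep
  have hmem : ∀ f ∈ (slowSpace m).toSubmodule,
      f ∘ (fun x => φ.eval x) ∈ (slowSpace m).toSubmodule := by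
    intro f hf
    obtain ⟨n, g, hg⟩ := exists_incl (FunctionSpace.Elem.mk f hf)
    have h1 : f = g.1 := (congrArg FunctionSpace.Elem.toFun hg).symm
    rw [h1, ← hAφ]
    exact (incl m (N n) (A n g)).2
  refine ⟨hmem, ?_⟩
  let T : (slowSpace m).Elem →ₗ[ℝ] (slowSpace m).Elem :=
    { toFun := fun f => FunctionSpace.Elem.mk _ (hmem f.toFun f.toFun_mem)
      map_add' := fun _ _ => rfl
      map_smul' := fun _ _ => rfl }
  refine continuous_of_inductiveTopology (j := fun n => incl m n) T fun n => ?_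
  refine ((continuous_incl m (N n)).comp (hA n)).congr fun f => FunctionSpace.Elem.ext fun x => ?_
  exact congrFun (hAφ n f) x

/-- The dilations of an element of `𝒪^m_n(ℝ)` converge to a constant in `𝒪^m_{n+1}(ℝ)`. -/
theorem tendsto_norm_dilation {n : ℕ} (f : GrowthStep m n) {p : ℝ} {s : ℕ → ℝ}
    (hs : ∀ n, s n ∈ Icc (-1 : ℝ) 1) (hs0 : Tendsto s atTop (𝓝 0))
    {u : ℕ → GrowthStep m (n + 1)} (hu : ∀ k, (u k).1 = fun x => f.1 (p + s k * (x - p)))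
    {g : GrowthStep m (n + 1)} (hg : g.1 = fun _ => f.1 p) :
    Tendsto u atTop (𝓝 g) := by
  obtain ⟨C, hC, hdil⟩ := GrowthStep.exists_dilation_le m n p
  rw [tendsto_iff_norm_sub_tendsto_zero, Metric.tendsto_nhds]
  intro ε' hε'
  obtain ⟨ε, hε, hεε'⟩ := exists_between hε'
  obtain ⟨δ, hδ, hfδ⟩ := Metric.continuousAt_iff.1
    ((f.contDiff (Nat.zero_le m)).continuous.continuousAt (x := p)) ε hε
  -- Beyond distance `R` from `p` the extra weight `1 + x ^ 2` exceeds `M`, which beats the sum of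
  -- the bounds for the dilated function and for `f p`. Within distance `R` the dilated point is
  -- `δ`-close to `p` once `s k` is small.
  let M := 2 * (C * ‖f‖) / ε
  have hM : 0 ≤ M := by positivity
  have hM' : M * ε = 2 * (C * ‖f‖) := div_mul_cancel₀ _ hε.ne'
  let R := |p| + M + 1
  have hR : ∀ x, R ≤ |x - p| → M ≤ 1 + x ^ 2 := by
    intro x hx
    have h1 : M + 1 ≤ |x| := by
      have := abs_sub x p
      simp only [R] at hx
      linarith
    rw [← sq_abs x]
    nlinarith
  have hs0' := hs0.abs
  rw [abs_zero] at hs0'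
  have hev1 : ∀ᶠ k in atTop, |s k| * R < δ := by
    have := hs0'.mul_const R
    rw [zero_mul] at this
    exact this.eventually (gt_mem_nhds hδ)
  have hev2 : ∀ᶠ k in atTop, |s k| * (C * ‖f‖) < ε := by
    have := hs0'.mul_const (C * ‖f‖)
    rw [zero_mul] at this
    exact this.eventually (gt_mem_nhds hε)
  filter_upwards [hev1, hev2] with k hk1 hk2
  rw [dist_zero_right, norm_norm]
  refine lt_of_le_of_lt (GrowthStep.norm_le hε.le fun i hi x => ?_) hεε'
  have h1 : 1 ≤ 1 + x ^ 2 := by nlinarith [sq_nonneg x]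
  have hsub : (u k - g).1 = (u k).1 - g.1 := rfl
  have h1n : 1 ≤ (1 + x ^ 2) ^ n := one_le_pow₀ h1
  rw [hsub, iteratedDeriv_sub ((u k).contDiff hi).contDiffAt (g.contDiff hi).contDiffAt, hu, hg,
    iteratedDeriv_dilation (f.contDiff hi)]
  -- Only order zero needs the extra weight: in positive order the constant drops out and the factor
  -- `s k ^ i` is small.
  rcases Nat.eq_zero_or_pos i with rfl | hi0
  · simp only [pow_zero, one_mul, iteratedDeriv_zero]
    rcases lt_or_ge |x - p| R with hx | hx
    · have h2 : |f.1 (p + s k * (x - p)) - f.1 p| < ε := by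
        refine hfδ ?_
        rw [Real.dist_eq, add_sub_cancel_left, abs_mul]
        exact lt_of_le_of_lt (by gcongr) hk1
      exact h2.le.trans (le_mul_of_one_le_right hε.le (one_le_pow₀ h1))
    · have h2 := hdil (s k) (hs k) f 0 (Nat.zero_le m) x
      -- Factor `0` in the dilation bound estimates the constant `f p`.
      have h3 := hdil 0 (by simp) f 0 (Nat.zero_le m) x
      rw [zero_mul, add_zero] at h3
      rw [iteratedDeriv_zero] at h2 h3
      calc |f.1 (p + s k * (x - p)) - f.1 p|
          ≤ |f.1 (p + s k * (x - p))| + |f.1 p| := abs_sub _ _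
        _ ≤ ε * (M * (1 + x ^ 2) ^ n) := by
          rw [← mul_assoc, mul_comm ε M, hM']
          linarith
        _ ≤ ε * ((1 + x ^ 2) * (1 + x ^ 2) ^ n) := by
          gcongr
          exact hR x hx
        _ = _ := by ring
  · have h2 := hdil (s k) (hs k) f i hi x
    have hc : iteratedDeriv i (fun _ : ℝ => f.1 p) x = 0 := by
      rw [iteratedDeriv_const, if_neg hi0.ne']
    have h3 : |s k| ^ i ≤ |s k| :=
      pow_le_of_le_one (abs_nonneg _) (abs_le.2 (hs k)) hi0.ne'
    rw [hc, sub_zero, abs_mul, abs_pow]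
    calc |s k| ^ i * |iteratedDeriv i f.1 (p + s k * (x - p))|
        ≤ |s k| * (C * ‖f‖ * (1 + x ^ 2) ^ n) := by gcongr
      _ = |s k| * (C * ‖f‖) * (1 + x ^ 2) ^ n := by ring
      _ ≤ ε * (1 + x ^ 2) ^ (n + 1) := by
        gcongr
        omega

theorem const_mem_growth (m n : ℕ) (c : ℝ) : (fun _ => c) ∈ growthSubmodule m n := by
  refine ⟨contDiff_const, |c|, fun i _ x => ?_⟩
  have h1 : 1 ≤ (1 + x ^ 2) ^ n := one_le_pow₀ (by nlinarith [sq_nonneg x])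
  rw [div_le_iff₀ (by positivity), iteratedDeriv_const]
  split_ifs
  · nlinarith [abs_nonneg c]
  · rw [abs_zero]
    positivity

/-- Convergence takes place in the step `n + 1`; equicontinuity only needs the step `n`, on which
the dilations have a common bound. Pointwise boundedness is read off from convergence. -/
theorem isContractive (m : ℕ) : (slowSpace m).IsContractive := by
  intro p s hs hs0 T hT
  have hstep : ∀ n, ∃ (A : ℕ → GrowthStep m n →+ GrowthStep m n) (C : ℝ),
      (∀ k f, (A k f).1 = fun x => f.1 (p + s k * (x - p))) ∧ ∀ k f, ‖A k f‖ ≤ C * ‖f‖ := by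
    intro n
    obtain ⟨C, hC, h⟩ := GrowthStep.exists_dilation_le m n p
    have h' : ∀ k (f : GrowthStep m n), ∀ i ≤ m, ∀ x,
        |iteratedDeriv i (fun x => f.1 (p + s k * (x - p))) x| ≤ C * ‖f‖ * (1 + x ^ 2) ^ n := by
      intro k f i hi x
      rw [iteratedDeriv_dilation (f.contDiff hi), abs_mul, abs_pow]
      refine (mul_le_of_le_one_left (abs_nonneg _) ?_).trans (h _ (hs k) f i hi x)
      exact pow_le_one₀ (abs_nonneg _) (abs_le.2 (hs k))
    let A : ℕ → GrowthStep m n →+ GrowthStep m n := fun k =>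
      { toFun := fun f => .mk (fun x => f.1 (p + s k * (x - p)))
          ((f.contDiff le_rfl).comp (by fun_prop)) (C * ‖f‖) (h' k f)
        map_zero' := rfl
        map_add' := fun _ _ => rfl }
    exact ⟨A, C, fun _ _ => rfl, fun k f => GrowthStep.norm_le (by positivity) (h' k f)⟩
  have hlim : ∀ f g : (slowSpace m).Elem, (∀ x, g.toFun x = f.toFun p) →
      Tendsto (fun n => T n f) atTop (𝓝 g) := by
    intro f g hg
    obtain ⟨n, f, rfl⟩ := exists_incl f
    obtain ⟨A, C, hA, -⟩ := hstep n
    let u : ℕ → GrowthStep m (n + 1) := fun k =>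
      ⟨(A k f).1, growthSubmodule_mono m n.le_succ (A k f).2⟩
    let g' : GrowthStep m (n + 1) := ⟨fun _ => f.1 p, const_mem_growth _ _ _⟩
    have h1 := ((continuous_incl m (n + 1)).tendsto g').comp
      (tendsto_norm_dilation f hs hs0 (u := u) (hA · f) rfl)
    have h2 : incl m (n + 1) g' = g := FunctionSpace.Elem.ext fun x => (hg x).symm
    rw [h2] at h1
    refine h1.congr fun k => FunctionSpace.Elem.ext fun x => ?_
    rw [hT]
    exact congrFun (hA k f) x
  refine ⟨hlim, equicontinuous_of_inductiveTopology (j := fun n => incl m n) (top_eq m) T ?_ ?_⟩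
  · intro f q hq
    obtain ⟨n, f, rfl⟩ := exists_incl f
    have h1 := hlim (incl m n f) (incl m 0 ⟨fun _ => f.1 p, const_mem_growth _ _ _⟩) fun x => rfl
    exact ((hq.tendsto _).comp h1).bddAbove_range
  · intro n f₀
    obtain ⟨A, C, hA, hAC⟩ := hstep n
    have h1 : ∀ (k : ℕ) (f : GrowthStep m n),
        T k (incl m n f - incl m n f₀) = incl m n (A k (f - f₀)) := by
      intro k f
      rw [← map_sub]
      refine FunctionSpace.Elem.ext fun x => ?_
      rw [hT]
      exact (congrFun (hA k (f - f₀)) x).symm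
    simp only [h1]
    have h2 := (continuous_incl m n).tendsto 0
    rw [map_zero] at h2
    refine h2.comp ?_
    have h3 : Tendsto (fun f : GrowthStep m n => C * ‖f - f₀‖) (𝓝 f₀) (𝓝 0) := by
      have := ((continuous_id.sub (continuous_const (y := f₀))).norm.const_mul C).tendsto f₀
      simpa using this
    exact squeeze_zero_norm (fun q => hAC q.1 (q.2 - f₀)) (h3.comp tendsto_snd)

theorem polynomial_mem (m : ℕ) (P : Polynomial ℝ) :
    (fun x => P.eval x) ∈ (slowSpace m).toSubmodule := by
  choose C k hC hk using fun i => (Polynomial.derivative^[i] P).exists_abs_eval_le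
  refine mem_iUnion.2 ⟨∑ i ∈ Finset.range (m + 1), k i, P.contDiff_eval m,
    ∑ i ∈ Finset.range (m + 1), C i, fun i hi x => ?_⟩
  have hi' : i ∈ Finset.range (m + 1) := Finset.mem_range.2 (by omega)
  have h1 : 1 ≤ 1 + x ^ 2 := by nlinarith [sq_nonneg x]
  have h2 : iteratedDeriv i (fun x => P.eval x) = fun x => (Polynomial.derivative^[i] P).eval x := by
    induction i with
    | zero => simp
    | succ i ih =>
      rw [iteratedDeriv_succ, ih (by omega) (Finset.mem_range.2 (by omega)),
        Function.iterate_succ_apply']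
      ext x
      exact Polynomial.deriv _
  rw [h2, div_le_iff₀ (by positivity)]
  refine (hk i x).trans ?_
  gcongr
  · exact Finset.sum_nonneg fun i _ => hC i
  · exact Finset.single_le_sum (fun i _ => hC i) hi'
  · exact Finset.single_le_sum (f := k) (fun i _ => Nat.zero_le _) hi'

end slowSpace

/-! ### Passage to the projective limit `𝒪_M(ℝ)` -/

namespace multiplierSpace

/-- The inclusion of `𝒪_M(ℝ)` into `𝒪^m(ℝ)`. -/
noncomputable def incl (m : ℕ) : multiplierSpace.Elem →ₗ[ℝ] (slowSpace m).Elem :=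
  multiplierIncl m

theorem incl_toFun (m : ℕ) (f : multiplierSpace.Elem) : (incl m f).toFun = f.toFun := rfl

theorem continuous_incl (m : ℕ) : Continuous (incl m) :=
  continuous_iff_le_induced.2 (iInf_le _ m)

theorem tendsto_iff {α : Type*} {l : Filter α} {u : α → multiplierSpace.Elem}
    {g : multiplierSpace.Elem} :
    Tendsto u l (𝓝 g) ↔ ∀ m, Tendsto (fun a => incl m (u a)) l (𝓝 (incl m g)) := by
  have h : 𝓝 g = ⨅ m, comap (incl m) (𝓝 (incl m g)) := by
    refine (nhds_iInf (a := (g : multiplierSubmodule))).trans (iInf_congr fun m => ?_)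
    exact nhds_induced _ _
  rw [h, tendsto_iInf]
  simp only [Filter.tendsto_comap_iff]
  rfl

theorem continuous_eval (x : ℝ) : Continuous fun f : multiplierSpace.Elem => f.toFun x :=
  (slowSpace.continuous_eval (m := 0) x).comp (continuous_incl 0)

theorem isSymbol (φ : Polynomial ℝ) : multiplierSpace.IsSymbol fun x => φ.eval x := by
  have hmem : ∀ f ∈ multiplierSpace.toSubmodule,
      f ∘ (fun x => φ.eval x) ∈ multiplierSpace.toSubmodule := fun f hf =>
    (Submodule.mem_iInf _).2 fun m =>
      (slowSpace.isSymbol m φ).comp_mem f ((Submodule.mem_iInf _).1 hf m)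
  refine ⟨hmem, ?_⟩
  rw [continuous_iff_continuousAt]
  intro g
  rw [ContinuousAt, tendsto_iff]
  intro m
  exact ((slowSpace.isSymbol m φ).continuous_comp.comp (continuous_incl m)).tendsto g

theorem polynomial_mem (P : Polynomial ℝ) : (fun x => P.eval x) ∈ multiplierSpace.toSubmodule :=
  (Submodule.mem_iInf _).2 fun m => slowSpace.polynomial_mem m P

/-- Limits in `𝒪_M(ℝ)` are tested in every `𝒪^m(ℝ)`, to which the dilations extend as composition
operators with affine symbols. -/
theorem isContractive : multiplierSpace.IsContractive := by
  intro p s hs hs0 T hT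
  have hP : ∀ t x : ℝ, (Polynomial.C p + Polynomial.C t * (Polynomial.X - Polynomial.C p)).eval x
      = p + t * (x - p) := by
    simp
  let S : ∀ m, ℕ → (slowSpace m).Elem →ₗ[ℝ] (slowSpace m).Elem := fun m n =>
    FunctionSpace.compositionOperator (slowSpace.isSymbol m
      (Polynomial.C p + Polynomial.C (s n) * (Polynomial.X - Polynomial.C p)))
  have hS : ∀ m n f x, (S m n f).toFun x = f.toFun (p + s n * (x - p)) := by
    intro m n f x
    rw [← hP]
    rfl
  have hST : ∀ m n f, incl m (T n f) = S m n (incl m f) := by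
    intro m n f
    refine FunctionSpace.Elem.ext fun x => ?_
    rw [hS, incl_toFun, incl_toFun, hT]
  refine ⟨fun f g hg => tendsto_iff.2 fun m => ?_, tendsto_iff.2 fun m => ?_⟩
  · simp only [hST]
    exact (slowSpace.isContractive m p s hs hs0 (S m) (hS m)).1 _ _ hg
  · rw [map_zero]
    have h1 := (slowSpace.isContractive m p s hs hs0 (S m) (hS m)).2
    have h2 := (continuous_incl m).tendsto 0
    rw [map_zero] at h2
    have h3 : Tendsto (fun q : ℕ × multiplierSpace.Elem => (q.1, incl m q.2)) (⊤ ×ˢ 𝓝 0)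
        (⊤ ×ˢ 𝓝 0) := tendsto_fst.prodMk (h2.comp tendsto_snd)
    exact (h1.comp h3).congr fun q => (hST m q.1 q.2).symm

end multiplierSpace

/-! ### The space `𝒜(ℝ)` -/

/-- A real analytic function extends holomorphically to a disc around each real point. -/
theorem AnalyticAt.exists_holomorphic_extension {f : ℝ → ℝ} {x : ℝ} (hf : AnalyticAt ℝ f x) :
    ∃ r > 0, ∃ F : ℂ → ℂ, DifferentiableOn ℂ F (Metric.ball (x : ℂ) r) ∧
      ∀ y : ℝ, (y : ℂ) ∈ Metric.ball (x : ℂ) r → F y = f y := by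
  obtain ⟨p, R, hp⟩ := hf
  -- The same Taylor coefficients, read as complex numbers, have the same norms and so the same
  -- radius of convergence.
  let c : ℕ → ℂ := fun n => (p.coeff n : ℂ)
  let P : FormalMultilinearSeries ℂ ℂ ℂ := FormalMultilinearSeries.ofScalars ℂ c
  have hnorm : ∀ n, ‖P n‖ = ‖p n‖ := by
    intro n
    rw [FormalMultilinearSeries.ofScalars_norm, p.norm_apply_eq_norm_coef, Complex.norm_real]
  have hrad : P.radius = p.radius := by
    simp only [FormalMultilinearSeries.radius, hnorm]
  -- The radius `R` may be infinite; a finite one is enough.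
  obtain ⟨r, hr0, hrR⟩ := ENNReal.lt_iff_exists_nnreal_btwn.1 hp.r_pos
  have hr0' : 0 < (r : ℝ) := by exact_mod_cast hr0
  have hrP : (r : ENNReal) ≤ P.radius := hrR.le.trans (hrad ▸ hp.r_le)
  have hP := ((P.hasFPowerSeriesOnBall ((by exact_mod_cast hr0 : (0 : ENNReal) < r).trans_le
    hrP)).mono (by exact_mod_cast hr0) hrP).comp_sub (x : ℂ)
  rw [zero_add] at hP
  refine ⟨r, hr0', fun z => P.sum (z - x), ?_, fun y hy => ?_⟩
  · have h1 := hP.differentiableOn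
    rwa [Metric.eball_coe] at h1
  · have hy' : |y - x| < r := by
      rwa [Metric.mem_ball, Complex.dist_eq, ← Complex.ofReal_sub, Complex.norm_real] at hy
    have h1 : y ∈ Metric.eball x R := by
      have : y ∈ Metric.eball x r := by
        rw [Metric.eball_coe, Metric.mem_ball, Real.dist_eq]
        exact hy'
      exact Metric.eball_subset_eball hrR.le this
    have h2 := hp.hasSum_sub h1
    have h3 : (y : ℂ) ∈ Metric.eball (x : ℂ) r := by rwa [Metric.eball_coe]
    have h4 := hP.hasSum_sub h3
    have h5 : (fun n => P n fun _ => (y : ℂ) - x) = fun n => ((p n fun _ => y - x : ℝ) : ℂ) := by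
      ext n
      simp [P, c, mul_comm]
    rw [h5] at h4
    exact h4.unique (Complex.hasSum_ofReal.2 h2)

namespace HolomorphicOn

/-- Every real analytic function extends holomorphically to a neighbourhood of `ℝ`. -/
theorem exists_toReal (f : analyticSubmodule) :
    ∃ (U : ComplexNhd) (F : HolomorphicOn U), toReal U F = f := by
  have hf : ∀ x, AnalyticAt ℝ f.1 x := fun x => f.2 x (mem_univ x)
  choose r hr F hF hFf using fun x => (hf x).exists_holomorphic_extension
  -- The discs have real centres, so with `z` their intersection contains `z.re`. It is convex,
  -- hence connected, and both extensions equal `f` on the reals near `z.re`: the identity theorem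
  -- applies.
  have hagree : ∀ x y : ℝ, EqOn (F x) (F y) (Metric.ball (x : ℂ) (r x) ∩ Metric.ball (y : ℂ) (r y)) := by
    intro x y z hz
    have hopen : IsOpen (Metric.ball (x : ℂ) (r x) ∩ Metric.ball (y : ℂ) (r y)) :=
      Metric.isOpen_ball.inter Metric.isOpen_ball
    have hre : ∀ x : ℝ, z ∈ Metric.ball (x : ℂ) (r x) → (z.re : ℂ) ∈ Metric.ball (x : ℂ) (r x) := by
      intro x hz
      rw [Metric.mem_ball, Complex.dist_eq] at hz ⊢
      refine lt_of_le_of_lt ?_ hz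
      rw [← Complex.ofReal_sub, Complex.norm_real]
      simpa using Complex.abs_re_le_norm (z - x)
    have hz' : (z.re : ℂ) ∈ Metric.ball (x : ℂ) (r x) ∩ Metric.ball (y : ℂ) (r y) :=
      ⟨hre x hz.1, hre y hz.2⟩
    refine AnalyticOnNhd.eqOn_of_preconnected_of_frequently_eq
      (((hF x).mono inter_subset_left).analyticOnNhd hopen)
      (((hF y).mono inter_subset_right).analyticOnNhd hopen)
      ((convex_ball _ _).inter (convex_ball _ _)).isPreconnected hz' ?_ hz
    have h1 : Tendsto (fun t : ℝ => (t : ℂ)) (𝓝[≠] z.re) (𝓝[≠] (z.re : ℂ)) :=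
      tendsto_nhdsWithin_iff.2
        ⟨(Complex.continuous_ofReal.tendsto z.re).mono_left nhdsWithin_le_nhds, by
          filter_upwards [self_mem_nhdsWithin] with t ht
          exact fun h => ht (Complex.ofReal_injective h)⟩
    refine h1.frequently (Eventually.frequently ?_)
    have h2 : ∀ᶠ t : ℝ in 𝓝[≠] z.re,
        (t : ℂ) ∈ Metric.ball (x : ℂ) (r x) ∩ Metric.ball (y : ℂ) (r y) :=
      (h1.mono_right nhdsWithin_le_nhds).eventually (hopen.mem_nhds hz')
    filter_upwards [h2] with t ht
    rw [hFf x t ht.1, hFf y t ht.2]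
  let V : Set ℂ := ⋃ x : ℝ, Metric.ball (x : ℂ) (r x)
  have hV : ∀ x : ℝ, (x : ℂ) ∈ V := fun x => mem_iUnion.2 ⟨x, Metric.mem_ball_self (hr x)⟩
  let U : ComplexNhd := ⟨V, isOpen_iUnion fun _ => Metric.isOpen_ball, hV⟩
  -- A choice of disc for each point, with the arbitrary centre `0` off `V`; by `hagree` the choice
  -- does not matter on `V`.
  have hc : ∀ z : ℂ, ∃ x : ℝ, z ∈ V → z ∈ Metric.ball (x : ℂ) (r x) := by
    intro z
    by_cases hz : z ∈ V
    · obtain ⟨x, hx⟩ := mem_iUnion.1 hz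
      exact ⟨x, fun _ => hx⟩
    · exact ⟨0, fun h => absurd h hz⟩
  choose c hc using hc
  let G : ℂ → ℂ := fun z => F (c z) z
  have hG : ∀ x : ℝ, EqOn G (F x) (Metric.ball (x : ℂ) (r x)) := fun x z hz =>
    hagree (c z) x ⟨hc z (mem_iUnion.2 ⟨x, hz⟩), hz⟩
  have hGf : ∀ x : ℝ, G x = f.1 x := fun x => by
    rw [hG x (Metric.mem_ball_self (hr x)), hFf x x (Metric.mem_ball_self (hr x))]
  refine ⟨U, ⟨G, fun z hz => ?_, fun x => by rw [hGf, Complex.ofReal_im]⟩,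
    Subtype.ext (funext fun x => ?_)⟩
  · obtain ⟨x, hx⟩ := mem_iUnion.1 hz
    have hn := Metric.isOpen_ball.mem_nhds hx
    exact (((hF x).differentiableAt hn).congr_of_eventuallyEq
      ((hG x).eventuallyEq_of_mem hn)).differentiableWithinAt
  · change (G x).re = f.1 x
    rw [hGf, Complex.ofReal_re]

section Pullback

variable {A : Type*} [TopologicalSpace A] [CompactSpace A] (ψ : C(A × ℂ, ℂ))
  (ψr : A → ℝ → ℝ)
  (hr : ∀ a (x : ℝ), ψ (a, x) = ψr a x)

/-- The points that a compact family of functions, real on `ℝ`, maps to `U`. -/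
def _root_.ComplexNhd.pullback (hr : ∀ a (x : ℝ), ψ (a, x) = ψr a x) (U : ComplexNhd) :
    ComplexNhd where
  val := {z | ∀ a, ψ (a, z) ∈ U.1}
  property := by
    refine ⟨?_, fun x a => by rw [hr]; exact U.2.2 _⟩
    -- The complement of the pullback is the projection of a closed set along the compact space `A`,
    -- hence closed.
    have h1 : IsClosed (Prod.snd '' (ψ ⁻¹' (U.1)ᶜ)) :=
      isClosedMap_snd_of_compactSpace _ (U.2.1.isClosed_compl.preimage ψ.continuous)
    convert h1.isOpen_compl using 1
    ext z
    simp

/-- The composition of a holomorphic function with a member of a compact family. -/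
noncomputable def pullback (hψ : ∀ a, Differentiable ℂ fun z => ψ (a, z)) {U : ComplexNhd} (a : A)
    (F : HolomorphicOn U) : HolomorphicOn (U.pullback ψ ψr hr) where
  val z := F.1 (ψ (a, z))
  property := ⟨F.2.1.comp (hψ a).differentiableOn fun z hz => hz a,
    fun x => by
      change (F.1 (ψ (a, x))).im = 0
      rw [hr]
      exact F.2.2 _⟩

theorem toReal_pullback (hψ : ∀ a, Differentiable ℂ fun z => ψ (a, z)) {U : ComplexNhd} (a : A) (F : HolomorphicOn U) (x : ℝ) :
    (toReal _ (pullback ψ ψr hr hψ a F)).1 x = (toReal U F).1 (ψr a x) := by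
  change (F.1 (ψ (a, x))).re = (F.1 (ψr a x)).re
  rw [hr]

/-- Composition is jointly continuous for the compact-open topologies because `U` is locally
compact. The domain of the pulled back functions is the same for all `a`, so a single step of the
limit receives the whole family. -/
theorem continuous_pullback (hψ : ∀ a, Differentiable ℂ fun z => ψ (a, z)) (U : ComplexNhd) :
    Continuous fun q : A × HolomorphicOn U => pullback ψ ψr hr hψ q.1 q.2 := by
  have : LocallyCompactSpace U.1 := U.2.1.locallyCompactSpace
  let V := U.pullback ψ ψr hr
  let γ : A → C(V.1, U.1) := fun a =>
    ⟨fun z => ⟨ψ (a, z), z.2 a⟩, by fun_prop⟩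
  have hγ : Continuous γ := ContinuousMap.continuous_of_continuous_uncurry _
    (Continuous.subtype_mk (ψ.continuous.comp
      (continuous_fst.prodMk (continuous_subtype_val.comp continuous_snd))) _)
  have hres : Continuous (restrict (U := U)) := continuous_induced_dom
  exact continuous_induced_rng.2
    ((hres.comp continuous_snd).compCM (hγ.comp continuous_fst))

end Pullback

end HolomorphicOn

namespace analyticSpace

/-- The restriction to `ℝ` as an element of `𝒜(ℝ)`. -/
noncomputable def incl (U : ComplexNhd) (F : HolomorphicOn U) : analyticSpace.Elem :=
  HolomorphicOn.toReal U F

theorem top_eq : analyticSpace.instTopologicalSpaceElem = inductiveTopology incl := rfl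

theorem continuous_incl (U : ComplexNhd) : Continuous (incl U) :=
  inductiveTopology_continuous HolomorphicOn.toReal U

theorem exists_incl (f : analyticSpace.Elem) : ∃ U F, incl U F = f :=
  HolomorphicOn.exists_toReal f

theorem continuous_eval (x : ℝ) : Continuous fun f : analyticSpace.Elem => f.toFun x := by
  have h : Continuous fun f : analyticSpace.Elem => f.toFun :=
    continuous_iff_le_induced.2
      (inductiveTopology_le_pointwise _ fun _ x => HolomorphicOn.continuous_toReal_apply x)
  exact (continuous_apply x).comp h

theorem polynomial_mem (P : Polynomial ℝ) : (fun x => P.eval x) ∈ analyticSpace.toSubmodule :=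
  fun _ _ => (AnalyticOnNhd.eval_polynomial P _ (mem_univ _))

/-- The polynomial extends to `ℂ`, and the family of maps to pull back along consists of this one
map, indexed by `Unit`. -/
theorem isSymbol (φ : Polynomial ℝ) : analyticSpace.IsSymbol fun x => φ.eval x := by
  have hmem : ∀ f ∈ analyticSpace.toSubmodule,
      f ∘ (fun x => φ.eval x) ∈ analyticSpace.toSubmodule := fun f hf x _ =>
    AnalyticAt.comp (hf (φ.eval x) (mem_univ _)) (polynomial_mem φ x (mem_univ _))
  refine ⟨hmem, ?_⟩
  let T : analyticSpace.Elem →ₗ[ℝ] analyticSpace.Elem :=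
    { toFun := fun f => FunctionSpace.Elem.mk _ (hmem f.toFun f.toFun_mem)
      map_add' := fun _ _ => rfl
      map_smul' := fun _ _ => rfl }
  refine continuous_of_inductiveTopology (j := incl) T fun U => ?_
  let ψ : C(Unit × ℂ, ℂ) :=
    ⟨fun q => Polynomial.aeval q.2 φ, (φ.continuous_aeval).comp continuous_snd⟩
  have hψ : ∀ a, Differentiable ℂ fun z => ψ (a, z) := fun _ => φ.differentiable_aeval
  have hr : ∀ a (x : ℝ), ψ (a, x) = (fun (_ : Unit) x => φ.eval x) a x := fun _ x =>
    Polynomial.aeval_algebraMap_apply_eq_algebraMap_eval x φ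
  have h1 := ((continuous_incl _).comp (HolomorphicOn.continuous_pullback ψ _ hr hψ U)).comp
    (continuous_const (y := ()).prodMk continuous_id)
  refine h1.congr fun F => FunctionSpace.Elem.ext fun x => ?_
  exact HolomorphicOn.toReal_pullback ψ _ hr hψ () F x

/-- The dilations with factors in `[-1, 1]` form a compact family, so for given `U` all dilated
functions live on one neighbourhood and depend continuously on factor and function. Both claims
follow as for `C^m(ℝ)`, with equicontinuity checked on the steps. -/
theorem isContractive : analyticSpace.IsContractive := by
  intro p s hs hs0 T hT
  let I := Icc (-1 : ℝ) 1
  let ψ : C(I × ℂ, ℂ) := ⟨fun q => p + (q.1 : ℝ) * (q.2 - p), by fun_prop⟩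
  have hψ : ∀ a, Differentiable ℂ fun z => ψ (a, z) := fun a => by
    simp only [ψ, ContinuousMap.coe_mk]
    fun_prop
  have hr : ∀ (a : I) (x : ℝ), ψ (a, x) = (fun (a : I) x => p + a * (x - p) : I → ℝ → ℝ) a x := by
    intro a x
    simp [ψ]
  let S : ∀ U, I × HolomorphicOn U → analyticSpace.Elem := fun U q =>
    incl _ (HolomorphicOn.pullback ψ _ hr hψ q.1 q.2)
  have hS : ∀ U, Continuous (S U) := fun U =>
    (continuous_incl _).comp (HolomorphicOn.continuous_pullback ψ _ hr hψ U)
  have hSapp : ∀ U a F x, (S U (a, F)).toFun x = (incl U F).toFun (p + a * (x - p)) :=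
    fun U a F x => HolomorphicOn.toReal_pullback ψ _ hr hψ a F x
  let σ : ℕ → I := fun n => ⟨s n, hs n⟩
  have hTS : ∀ n U F, T n (incl U F) = S U (σ n, F) := fun n U F =>
    FunctionSpace.Elem.ext fun x => by rw [hT, hSapp]
  have h0 : (0 : ℝ) ∈ I := by simp [I]
  have hlim : ∀ f g : analyticSpace.Elem, (∀ x, g.toFun x = f.toFun p) →
      Tendsto (fun n => T n f) atTop (𝓝 g) := by
    intro f g hg
    obtain ⟨U, F, rfl⟩ := exists_incl f
    have h1 : S U (⟨0, h0⟩, F) = g := FunctionSpace.Elem.ext fun x => by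
      rw [hSapp, hg]
      simp
    have hσ : Tendsto σ atTop (𝓝 ⟨0, h0⟩) := tendsto_subtype_rng.2 hs0
    have h2 := ((hS U).tendsto (⟨0, h0⟩, F)).comp (hσ.prodMk_nhds (tendsto_const_nhds (x := F)))
    rw [h1] at h2
    exact h2.congr fun n => (hTS n U F).symm
  refine ⟨hlim, equicontinuous_of_inductiveTopology top_eq T ?_ ?_⟩
  · intro f q hq
    have hc : (fun x => (Polynomial.C (f.toFun p)).eval x) ∈ analyticSpace.toSubmodule :=
      polynomial_mem _
    have h1 := hlim f (FunctionSpace.Elem.mk _ hc) fun x => Polynomial.eval_C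
    exact ((hq.tendsto _).comp h1).bddAbove_range
  · intro U F₀
    have h1 : ∀ n F, T n (incl U F - incl U F₀) = S U (σ n, F) - S U (σ n, F₀) := fun n F => by
      rw [map_sub, hTS, hTS]
    simp only [h1]
    -- Differences are formed in `𝒜(ℝ)`, so the map that vanishes at `F₀` for every factor is `S U q
    -- - S U (q.1, F₀)`.
    exact tendsto_of_continuous_of_isCompact isCompact_univ
      (G := fun q : I × HolomorphicOn U => S U q - S U (q.1, F₀))
      ((hS U).sub ((hS U).comp (continuous_fst.prodMk continuous_const)))
      (fun a _ => sub_self _) (fun n => mem_univ (σ n))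

end analyticSpace

/-! ### The theorem for the concrete spaces -/

namespace FunctionSpace

/-- The mean ergodic theorem for a contractive space on which all polynomials are symbols. -/
theorem exists_isSymbol_meanErgodic_iff (φ : Polynomial ℝ) {X : FunctionSpace}
    (h : X.IsSymbol fun x => φ.eval x) (heval : ∀ x, Continuous fun f : X.Elem => f.toFun x)
    (hpoly : ∀ P : Polynomial ℝ, (fun x => P.eval x) ∈ X.toSubmodule) (hX : X.IsContractive) :
    ∃ h : X.IsSymbol (fun x => φ.eval x),
      (IsMeanErgodic (FunctionSpace.compositionOperator h) ↔
        IsPowerBounded (FunctionSpace.compositionOperator h)) ∧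
      (IsPowerBounded (FunctionSpace.compositionOperator h) ↔
        ∃ a b : ℝ, φ = Polynomial.C a * Polynomial.X + Polynomial.C b ∧
          (|a| < 1 ∨ a = -1 ∨ (a = 1 ∧ b = 0))) ∧
      ∀ a b : ℝ, φ = Polynomial.C a * Polynomial.X + Polynomial.C b → |a| < 1 →
        ConvergesStrongly fun n : ℕ => FunctionSpace.compositionOperator (h.iterate n) := by
  have hsq : (fun x : ℝ => x ^ 2) = fun x => (Polynomial.X ^ 2 : Polynomial ℝ).eval x := by
    ext x
    rw [Polynomial.eval_pow, Polynomial.eval_X]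
  exact ⟨h, meanErgodic_iff_of_isContractive φ h heval
    (by simpa only [Polynomial.eval_one] using hpoly 1) (hsq ▸ hpoly _) hX⟩

end FunctionSpace

theorem theorem4p5 (φ : Polynomial ℝ) (X : FunctionSpace)
    (hX : X = multiplierSpace ∨ X = smoothSpace ⊤ ∨ X = analyticSpace ∨
      (∃ m : ℕ, X = slowSpace m) ∨ ∃ m : ℕ, X = smoothSpace m) :
    ∃ h : X.IsSymbol (fun x => φ.eval x),
      (IsMeanErgodic (FunctionSpace.compositionOperator h) ↔
        IsPowerBounded (FunctionSpace.compositionOperator h)) ∧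
      (IsPowerBounded (FunctionSpace.compositionOperator h) ↔
        ∃ a b : ℝ, φ = Polynomial.C a * Polynomial.X + Polynomial.C b ∧
          (|a| < 1 ∨ a = -1 ∨ (a = 1 ∧ b = 0))) ∧
      ∀ a b : ℝ, φ = Polynomial.C a * Polynomial.X + Polynomial.C b → |a| < 1 →
        ConvergesStrongly fun n : ℕ => FunctionSpace.compositionOperator (h.iterate n) := by
  have hsmooth : ∀ m : ℕ∞, _ := fun m =>
    FunctionSpace.exists_isSymbol_meanErgodic_iff φ (smoothSpace.isSymbol m φ)
      smoothSpace.continuous_eval (fun P => P.contDiff_eval m) (smoothSpace.isContractive m)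
  rcases hX with rfl | rfl | rfl | ⟨m, rfl⟩ | ⟨m, rfl⟩
  · exact FunctionSpace.exists_isSymbol_meanErgodic_iff φ (multiplierSpace.isSymbol φ)
      multiplierSpace.continuous_eval multiplierSpace.polynomial_mem multiplierSpace.isContractive
  · exact hsmooth ⊤
  · exact FunctionSpace.exists_isSymbol_meanErgodic_iff φ (analyticSpace.isSymbol φ)
      analyticSpace.continuous_eval analyticSpace.polynomial_mem analyticSpace.isContractive
  · exact FunctionSpace.exists_isSymbol_meanErgodic_iff φ (slowSpace.isSymbol m φ)
      slowSpace.continuous_eval (slowSpace.polynomial_mem m) (slowSpace.isContractive m)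
  · exact hsmooth m
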